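/- **Setting.** Let $\mathcal X_1,\mathcal X_2$ be measurable spaces with reference measures $\nu_1,\nu_2$, let $\Theta_1\subseteq\mathbb R^{d_1}$, $\Theta_2\subseteq\mathbb R^{d_2}$, and let $f_1(\cdot|\theta_1)$ ($\theta_1\in\Theta_1$) and $f_2(\cdot|\theta_1,\theta_2)$ ($\theta_1\in\Theta_1,\theta_2\in\Theta_2$) be probability densities with respect to $\nu_1$ and $\nu_2$. Write $\ell_1=\log f_1$, $\ell_2=\log f_2$ (with $\log 0=-\infty$). The data are two sequences, independent of each other: $X_{1,1},X_{1,2},\dots$ i.i.d. with $\nu_1$-density $p_1^*$, and $X_{2,1},X_{2,2},\dots$ i.i.d. with $\nu_2$-density $p_2^*$ (Scenario 1). The densities $p_1^*,p_2^*$ need not belong to the model. Expectations $E_{p_i^*}$ are under $p_i^*$, and $P$ is the probability governing the data. **Regularity conditions.** 1. $\ell_1,\ell_2$ are measurable in the observation and bounded from above, and $E_{p_1^*}|\ell_1(X_1,\theta_1)|<\infty$, $E_{p_2^*}|\ell_2(X_2,\theta_1,\theta_2)|<\infty$ for all $\theta_1\in\Theta_1,\theta_2\in\Theta_2$. 2.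 $\theta_1^*$ is the unique maximizer over $\Theta_1$ of $\theta_1\mapsto E_{p_1^*}\ell_1(X_1,\theta_1)$. There is an open ball $B\subseteq\Theta_1$ around $\theta_1^*$ such that for every $\theta_1\in B$ the map $\theta_2\mapsto E_{p_2^*}\ell_2(X_2,\theta_1,\theta_2)$ has a unique maximizer over $\Theta_2$; for $\theta_1=\theta_1^*$ it is $\theta_2^*$. For every $\delta>0$ there is $\varepsilon>0$ with $$P\Big[\sup_{\theta_1\in\Theta_1,\ \|\theta_1-\theta_1^*\|\ge\delta}\tfrac1n\sum_{j=1}^n\{\ell_1(X_{1,j},\theta_1)-\ell_1(X_{1,j},\theta_1^*)\}\le-\varepsilon\Big]\to1\qquad(n\to\infty),$$ and for every $\delta>0$ there are $\varepsilon,\eta>0$ with $$P\Big[\sup_{\substack{\theta_1\in\Theta_1,\ \|\theta_1-\theta_1^*\|<\eta\\ \theta_2\in\Theta_2,\ \|\theta_2-\theta_2^*\|\ge\delta}}\tfrac1n\sum_{j=1}^n\{\ell_2(X_{2,j},\theta_1,\theta_2)-\ell_2(X_{2,j},\theta_1^*,\theta_2^*)\}\le-\varepsilon\Big]\to1\qquad(n\to\infty).$$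 3. There are open balls $B_1\subseteq\Theta_1$, $B_2\subseteq\Theta_2$ around $\theta_1^*,\theta_2^*$ such that, almost surely in the observation, $\ell_1$ is finite and three times continuously differentiable in $\theta_1\in B_1$, and $\ell_2$ is finite and three times continuously differentiable in $(\theta_1,\theta_2)\in B_1\times B_2$. On $B_1$, all partial derivatives of $\ell_1$ of order $1,2,3$ are bounded in absolute value by measurable functions $G_1,G_2,G_3$ of $x_1$ with $E_{p_1^*}G_1^4,\ E_{p_1^*}G_2^4,\ E_{p_1^*}G_3<\infty$. On $B_1\times B_2$, all partial derivatives of $\ell_2$ of order $1,2,3$ (with respect to all $d_1+d_2$ coordinates) are bounded in absolute value by measurable functions $G_4,G_5,G_6$ of $x_2$ with $E_{p_2^*}G_4^4,\ E_{p_2^*}G_5^4,\ E_{p_2^*}G_6<\infty$. 4. On $B_1$, respectively $B_1\times B_2$, the following matrices are positive definite: $$I_1(\theta_1)=E_{p_1^*}\Big\{\tfrac{\partial\ell_1}{\partial\theta_1}\big(\tfrac{\partial\ell_1}{\partial\theta_1}\big)^T\Big\},\quad J_1(\theta_1)=-E_{p_1^*}\Big\{\tfrac{\partial^2\ell_1}{\partial\theta_1\partial\theta_1^T}\Big\},\quad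 I_2(\theta_1,\theta_2)=E_{p_2^*}\Big\{\tfrac{\partial\ell_2}{\partial\theta_2}\big(\tfrac{\partial\ell_2}{\partial\theta_2}\big)^T\Big\},\quad J_2(\theta_1,\theta_2)=-E_{p_2^*}\Big\{\tfrac{\partial^2\ell_2}{\partial\theta_2\partial\theta_2^T}\Big\}.$$ **Estimators.** Let $n_1,n_2\to\infty$ along a sequence with $n_1/n_2\to\alpha$ for some $\alpha>0$. Let $\hat\theta_1,\hat\theta_2$ be random vectors such that, with probability tending to one, $$\hat\theta_1\in\arg\max_{\theta_1\in\Theta_1}\sum_{j=1}^{n_1}\log f_1(X_{1,j}|\theta_1),\qquad \hat\theta_2\in\arg\max_{\theta_2\in\Theta_2}\sum_{j=1}^{n_2}\log f_2(X_{2,j}|\hat\theta_1,\theta_2).$$ **Proposition.** Let $I_1^*=I_1(\theta_1^*)$, $J_1^*=J_1(\theta_1^*)$, $I_2^*=I_2(\theta_1^*,\theta_2^*)$, $J_2^*=J_2(\theta_1^*,\theta_2^*)$, $R_J^*=-E_{p_2^*}\big\{\partial^2\ell_2(X_2,\theta_1^*,\theta_2^*)/\partial\theta_1\partial\theta_2^T\big\}$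 (a $d_1\times d_2$ matrix) and $S_1=J_1^{*-1}I_1^*J_1^{*-1}$. Then the matrix $$\Sigma=\begin{pmatrix}\frac1\alpha S_1&-\frac1\alpha S_1R_J^*J_2^{*-1}\\[2pt]-\frac1\alpha J_2^{*-1}R_J^{*T}S_1&J_2^{*-1}\big(I_2^*+R_J^{*T}\,\frac1\alpha S_1\,R_J^*\big)J_2^{*-1}\end{pmatrix}$$ is positive semidefinite, and $\sqrt{n_2}\,(\hat\theta_1-\theta_1^*,\hat\theta_2-\theta_2^*)$ converges in distribution to $N(0,\Sigma)$. -/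

import Mathlib

open MeasureTheory ProbabilityTheory Filter Topology
open scoped NNReal ENNReal

/-! ### Parameters and partial derivatives -/

/-- The concatenation `(θ₁, θ₂)` as a vector of `ℝ^(d₁ + d₂)`, with coordinates indexed by
`Fin d₁ ⊕ Fin d₂`. -/
def joinParam {d₁ d₂ : ℕ} (θ₁ : EuclideanSpace ℝ (Fin d₁)) (θ₂ : EuclideanSpace ℝ (Fin d₂)) :
    EuclideanSpace ℝ (Fin d₁ ⊕ Fin d₂) :=
  WithLp.toLp 2 (Sum.elim (fun i => θ₁ i) (fun i => θ₂ i))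

/-- The first block of a vector of `ℝ^(d₁ + d₂)`. -/
def fstParam {d₁ d₂ : ℕ} (θ : EuclideanSpace ℝ (Fin d₁ ⊕ Fin d₂)) : EuclideanSpace ℝ (Fin d₁) :=
  WithLp.toLp 2 (fun i => θ (Sum.inl i))

/-- The second block of a vector of `ℝ^(d₁ + d₂)`. -/
def sndParam {d₁ d₂ : ℕ} (θ : EuclideanSpace ℝ (Fin d₁ ⊕ Fin d₂)) : EuclideanSpace ℝ (Fin d₂) :=
  WithLp.toLp 2 (fun i => θ (Sum.inr i))

/-- The partial derivative `∂g/∂θ_i`. It is only used at points near which `g` is of class `C^3`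
or, in iterated form, applied to partial derivatives of such a function. -/
noncomputable def pderiv {ι : Type*} [Fintype ι] [DecidableEq ι] (i : ι)
    (g : EuclideanSpace ℝ ι → ℝ) (θ : EuclideanSpace ℝ ι) : ℝ :=
  fderiv ℝ g θ (EuclideanSpace.single i 1)

/-- The matrix `E_Q {∂ℓ(X, θ)/∂θ (∂ℓ(X, θ)/∂θ)ᵀ}`. -/
noncomputable def scoreMatrix {𝒳 : Type*} [MeasurableSpace 𝒳] {ι : Type*} [Fintype ι]
    [DecidableEq ι] (Q : Measure 𝒳) (ℓ : 𝒳 → EuclideanSpace ℝ ι → ℝ) (θ : EuclideanSpace ℝ ι) :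
    Matrix ι ι ℝ :=
  Matrix.of fun i j => ∫ x, pderiv i (ℓ x) θ * pderiv j (ℓ x) θ ∂Q

/-- The matrix `- E_Q {∂²ℓ(X, θ)/∂θ∂θᵀ}`. -/
noncomputable def negHessianMatrix {𝒳 : Type*} [MeasurableSpace 𝒳] {ι : Type*} [Fintype ι]
    [DecidableEq ι] (Q : Measure 𝒳) (ℓ : 𝒳 → EuclideanSpace ℝ ι → ℝ) (θ : EuclideanSpace ℝ ι) :
    Matrix ι ι ℝ :=
  Matrix.of fun i j => - ∫ x, pderiv i (pderiv j (ℓ x)) θ ∂Q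

/-- `t` is the unique maximizer of `g` over `S`. -/
def IsUniqueMaximizer {E : Type*} (g : E → ℝ) (S : Set E) (t : E) : Prop :=
  t ∈ S ∧ ∀ s ∈ S, s ≠ t → g s < g t

/-! ### The two-module model -/

/-- The likelihood part of a two-module model: densities `f₁ (· | θ₁)` and `f₂ (· | θ₁, θ₂)` with
respect to reference measures `ν₁`, `ν₂`, for `θ₁ ∈ Θ₁ ⊆ ℝ^d₁` and `θ₂ ∈ Θ₂ ⊆ ℝ^d₂`. -/
structure CutModel (𝒳₁ 𝒳₂ : Type*) [MeasurableSpace 𝒳₁] [MeasurableSpace 𝒳₂] (d₁ d₂ : ℕ) where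
  ν₁ : Measure 𝒳₁
  ν₂ : Measure 𝒳₂
  Θ₁ : Set (EuclideanSpace ℝ (Fin d₁))
  Θ₂ : Set (EuclideanSpace ℝ (Fin d₂))
  f₁ : EuclideanSpace ℝ (Fin d₁) → 𝒳₁ → ℝ≥0
  f₂ : EuclideanSpace ℝ (Fin d₁) → EuclideanSpace ℝ (Fin d₂) → 𝒳₂ → ℝ≥0
  measurable_f₁ : ∀ θ₁ ∈ Θ₁, Measurable (f₁ θ₁)
  measurable_f₂ : ∀ θ₁ ∈ Θ₁, ∀ θ₂ ∈ Θ₂, Measurable (f₂ θ₁ θ₂)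
  lintegral_f₁ : ∀ θ₁ ∈ Θ₁, ∫⁻ x, (f₁ θ₁ x : ℝ≥0∞) ∂ν₁ = 1
  lintegral_f₂ : ∀ θ₁ ∈ Θ₁, ∀ θ₂ ∈ Θ₂, ∫⁻ x, (f₂ θ₁ θ₂ x : ℝ≥0∞) ∂ν₂ = 1

namespace CutModel

variable {𝒳₁ 𝒳₂ : Type*} [MeasurableSpace 𝒳₁] [MeasurableSpace 𝒳₂] {d₁ d₂ : ℕ}

/-- `ℓ₁(x₁, θ₁) = log f₁(x₁ | θ₁)` as a real number (used where `f₁ > 0`). -/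
noncomputable def ell₁ (m : CutModel 𝒳₁ 𝒳₂ d₁ d₂) (x : 𝒳₁) (θ₁ : EuclideanSpace ℝ (Fin d₁)) : ℝ :=
  Real.log (m.f₁ θ₁ x)

/-- `ℓ₂(x₂, θ) = log f₂(x₂ | θ₁, θ₂)` for `θ = (θ₁, θ₂)`, as a real number
(used where `f₂ > 0`). -/
noncomputable def ell₂ (m : CutModel 𝒳₁ 𝒳₂ d₁ d₂) (x : 𝒳₂)
    (θ : EuclideanSpace ℝ (Fin d₁ ⊕ Fin d₂)) : ℝ :=
  Real.log (m.f₂ (fstParam θ) (sndParam θ) x)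

/-- `∑_{j < n} log f₁(x_j | θ₁)`, in `[-∞, ∞)`, with `log 0 = -∞`. -/
noncomputable def logLik₁ (m : CutModel 𝒳₁ 𝒳₂ d₁ d₂) (n : ℕ) (x : ℕ → 𝒳₁)
    (θ₁ : EuclideanSpace ℝ (Fin d₁)) : EReal :=
  ∑ j ∈ Finset.range n, ENNReal.log (m.f₁ θ₁ (x j))

/-- `∑_{j < n} log f₂(x_j | θ₁, θ₂)`, in `[-∞, ∞)`, with `log 0 = -∞`. -/
noncomputable def logLik₂ (m : CutModel 𝒳₁ 𝒳₂ d₁ d₂) (n : ℕ) (x : ℕ → 𝒳₂)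
    (θ₁ : EuclideanSpace ℝ (Fin d₁)) (θ₂ : EuclideanSpace ℝ (Fin d₂)) : EReal :=
  ∑ j ∈ Finset.range n, ENNReal.log (m.f₂ θ₁ θ₂ (x j))

/-- `t₁ ∈ arg max_{θ₁ ∈ Θ₁} ∑_j log f₁(x_j | θ₁)`. -/
def IsFirstStageMLE (m : CutModel 𝒳₁ 𝒳₂ d₁ d₂) (n : ℕ) (x : ℕ → 𝒳₁)
    (t₁ : EuclideanSpace ℝ (Fin d₁)) : Prop :=
  t₁ ∈ m.Θ₁ ∧ ∀ θ₁ ∈ m.Θ₁, m.logLik₁ n x θ₁ ≤ m.logLik₁ n x t₁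

/-- `t₂ ∈ arg max_{θ₂ ∈ Θ₂} ∑_j log f₂(x_j | t₁, θ₂)`, for a given first-stage value `t₁`. -/
def IsSecondStageMLE (m : CutModel 𝒳₁ 𝒳₂ d₁ d₂) (n : ℕ) (x : ℕ → 𝒳₂)
    (t₁ : EuclideanSpace ℝ (Fin d₁)) (t₂ : EuclideanSpace ℝ (Fin d₂)) : Prop :=
  t₂ ∈ m.Θ₂ ∧ ∀ θ₂ ∈ m.Θ₂, m.logLik₂ n x t₁ θ₂ ≤ m.logLik₂ n x t₁ t₂

/-! ### Information matrices -/

/-- `I₁(θ₁)`. -/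
noncomputable def I₁ (m : CutModel 𝒳₁ 𝒳₂ d₁ d₂) (Q₁ : Measure 𝒳₁)
    (θ₁ : EuclideanSpace ℝ (Fin d₁)) : Matrix (Fin d₁) (Fin d₁) ℝ :=
  scoreMatrix Q₁ m.ell₁ θ₁

/-- `J₁(θ₁)`. -/
noncomputable def J₁ (m : CutModel 𝒳₁ 𝒳₂ d₁ d₂) (Q₁ : Measure 𝒳₁)
    (θ₁ : EuclideanSpace ℝ (Fin d₁)) : Matrix (Fin d₁) (Fin d₁) ℝ :=
  negHessianMatrix Q₁ m.ell₁ θ₁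

/-- `I₂(θ₁, θ₂)`: the score is taken with respect to `θ₂` only. -/
noncomputable def I₂ (m : CutModel 𝒳₁ 𝒳₂ d₁ d₂) (Q₂ : Measure 𝒳₂)
    (θ₁ : EuclideanSpace ℝ (Fin d₁)) (θ₂ : EuclideanSpace ℝ (Fin d₂)) :
    Matrix (Fin d₂) (Fin d₂) ℝ :=
  (scoreMatrix Q₂ m.ell₂ (joinParam θ₁ θ₂)).toBlocks₂₂

/-- `J₂(θ₁, θ₂) = - E {∂²ℓ₂/∂θ₂∂θ₂ᵀ}`. -/
noncomputable def J₂ (m : CutModel 𝒳₁ 𝒳₂ d₁ d₂) (Q₂ : Measure 𝒳₂)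
    (θ₁ : EuclideanSpace ℝ (Fin d₁)) (θ₂ : EuclideanSpace ℝ (Fin d₂)) :
    Matrix (Fin d₂) (Fin d₂) ℝ :=
  (negHessianMatrix Q₂ m.ell₂ (joinParam θ₁ θ₂)).toBlocks₂₂

/-- `R_J(θ₁, θ₂) = - E {∂²ℓ₂/∂θ₁∂θ₂ᵀ}`, a `d₁ × d₂` matrix. -/
noncomputable def RJ (m : CutModel 𝒳₁ 𝒳₂ d₁ d₂) (Q₂ : Measure 𝒳₂)
    (θ₁ : EuclideanSpace ℝ (Fin d₁)) (θ₂ : EuclideanSpace ℝ (Fin d₂)) :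
    Matrix (Fin d₁) (Fin d₂) ℝ :=
  (negHessianMatrix Q₂ m.ell₂ (joinParam θ₁ θ₂)).toBlocks₁₂

/-- `S₁ = J₁⁻¹ I₁ J₁⁻¹`. -/
noncomputable def S₁ (m : CutModel 𝒳₁ 𝒳₂ d₁ d₂) (Q₁ : Measure 𝒳₁)
    (θ₁ : EuclideanSpace ℝ (Fin d₁)) : Matrix (Fin d₁) (Fin d₁) ℝ :=
  (m.J₁ Q₁ θ₁)⁻¹ * m.I₁ Q₁ θ₁ * (m.J₁ Q₁ θ₁)⁻¹

/-- The asymptotic covariance matrix `Σ`. -/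
noncomputable def asympCov (m : CutModel 𝒳₁ 𝒳₂ d₁ d₂) (Q₁ : Measure 𝒳₁) (Q₂ : Measure 𝒳₂)
    (θ₁ : EuclideanSpace ℝ (Fin d₁)) (θ₂ : EuclideanSpace ℝ (Fin d₂)) (α : ℝ) :
    Matrix (Fin d₁ ⊕ Fin d₂) (Fin d₁ ⊕ Fin d₂) ℝ :=
  Matrix.fromBlocks
    ((1 / α) • m.S₁ Q₁ θ₁)
    (-((1 / α) • (m.S₁ Q₁ θ₁ * m.RJ Q₂ θ₁ θ₂ * (m.J₂ Q₂ θ₁ θ₂)⁻¹)))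
    (-((1 / α) • ((m.J₂ Q₂ θ₁ θ₂)⁻¹ * (m.RJ Q₂ θ₁ θ₂).transpose * m.S₁ Q₁ θ₁)))
    ((m.J₂ Q₂ θ₁ θ₂)⁻¹ *
      (m.I₂ Q₂ θ₁ θ₂ +
        (m.RJ Q₂ θ₁ θ₂).transpose * ((1 / α) • m.S₁ Q₁ θ₁) * m.RJ Q₂ θ₁ θ₂) *
      (m.J₂ Q₂ θ₁ θ₂)⁻¹)

/-! ### The data -/

/-- Independent data for the two modules: the `X₁ j` are i.i.d. with density `p₁` with respect to
`ν₁`, the `X₂ j` are i.i.d. with density `p₂` with respect to `ν₂`, and the two sequences are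
independent of each other. Neither `p₁` nor `p₂` has to belong to the model. -/
structure IndependentData (m : CutModel 𝒳₁ 𝒳₂ d₁ d₂) {Ω : Type*} [MeasurableSpace Ω]
    (P : Measure Ω) (p₁ : 𝒳₁ → ℝ≥0∞) (p₂ : 𝒳₂ → ℝ≥0∞)
    (X₁ : ℕ → Ω → 𝒳₁) (X₂ : ℕ → Ω → 𝒳₂) : Prop where
  measurable_p₁ : Measurable p₁
  measurable_p₂ : Measurable p₂
  measurable₁ : ∀ j, Measurable (X₁ j)
  measurable₂ : ∀ j, Measurable (X₂ j)
  law₁ : ∀ j, P.map (X₁ j) = m.ν₁.withDensity p₁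
  law₂ : ∀ j, P.map (X₂ j) = m.ν₂.withDensity p₂
  indep₁ : iIndepFun X₁ P
  indep₂ : iIndepFun X₂ P
  indep₁₂ : IndepFun (fun ω j => X₁ j ω) (fun ω j => X₂ j ω) P

/-! ### Regularity conditions -/

/-- The log likelihoods are bounded from above, and `E|ℓ₁|`, `E|ℓ₂|` are finite at all parameters
(in particular the likelihoods vanish with probability `0`). -/
structure LogLikCondition (m : CutModel 𝒳₁ 𝒳₂ d₁ d₂) (Q₁ : Measure 𝒳₁) (Q₂ : Measure 𝒳₂) :
    Prop where
  bdd₁ : ∃ C : ℝ, ∀ θ₁ ∈ m.Θ₁, ∀ x, ENNReal.log (m.f₁ θ₁ x) ≤ (C : EReal)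
  bdd₂ : ∃ C : ℝ, ∀ θ₁ ∈ m.Θ₁, ∀ θ₂ ∈ m.Θ₂, ∀ x, ENNReal.log (m.f₂ θ₁ θ₂ x) ≤ (C : EReal)
  pos₁ : ∀ θ₁ ∈ m.Θ₁, ∀ᵐ x ∂Q₁, 0 < m.f₁ θ₁ x
  pos₂ : ∀ θ₁ ∈ m.Θ₁, ∀ θ₂ ∈ m.Θ₂, ∀ᵐ x ∂Q₂, 0 < m.f₂ θ₁ θ₂ x
  integrable₁ : ∀ θ₁ ∈ m.Θ₁, Integrable (fun x => m.ell₁ x θ₁) Q₁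
  integrable₂ : ∀ θ₁ ∈ m.Θ₁, ∀ θ₂ ∈ m.Θ₂, Integrable (fun x => m.ell₂ x (joinParam θ₁ θ₂)) Q₂

/-- Identifiability. The inequality `(1/n) ∑_j {ℓ(X_j, θ) - ℓ(X_j, θ*)} ≤ -ε` is written as
`∑_j ℓ(X_j, θ) ≤ ∑_j ℓ(X_j, θ*) - n ε`, and "the probability that the supremum over `θ` is at most
`-ε` tends to `1`" is expressed by the (outer) probability of the complement tending to `0`, so
that no measurability of the supremum is presupposed. -/
structure IdentifiabilityCondition (m : CutModel 𝒳₁ 𝒳₂ d₁ d₂) (Q₁ : Measure 𝒳₁) (Q₂ : Measure 𝒳₂)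
    {Ω : Type*} [MeasurableSpace Ω] (P : Measure Ω) (X₁ : ℕ → Ω → 𝒳₁) (X₂ : ℕ → Ω → 𝒳₂)
    (θ₁s : EuclideanSpace ℝ (Fin d₁)) (θ₂s : EuclideanSpace ℝ (Fin d₂)) : Prop where
  /-- `θ₁s` is the pseudo-true parameter of the first module. -/
  unique₁ : IsUniqueMaximizer (fun θ₁ => ∫ x, m.ell₁ x θ₁ ∂Q₁) m.Θ₁ θ₁s
  /-- `θ₂s` is the pseudo-true parameter of the second module given `θ₁s`. -/
  unique₂ : IsUniqueMaximizer (fun θ₂ => ∫ x, m.ell₂ x (joinParam θ₁s θ₂) ∂Q₂) m.Θ₂ θ₂s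
  /-- The second module has a unique maximizer for every `θ₁` near `θ₁s`. -/
  unique₂_near : ∃ r > 0, Metric.ball θ₁s r ⊆ m.Θ₁ ∧ ∀ θ₁ ∈ Metric.ball θ₁s r,
    ∃ t₂, IsUniqueMaximizer (fun θ₂ => ∫ x, m.ell₂ x (joinParam θ₁ θ₂) ∂Q₂) m.Θ₂ t₂
  separated₁ : ∀ δ > (0 : ℝ), ∃ ε > (0 : ℝ),
    Tendsto (fun n : ℕ => P {ω | ¬ ∀ θ₁ ∈ m.Θ₁, δ ≤ ‖θ₁ - θ₁s‖ →
      m.logLik₁ n (fun j => X₁ j ω) θ₁ ≤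
        m.logLik₁ n (fun j => X₁ j ω) θ₁s - ((n * ε : ℝ) : EReal)}) atTop (𝓝 0)
  separated₂ : ∀ δ > (0 : ℝ), ∃ ε > (0 : ℝ), ∃ η > (0 : ℝ),
    Tendsto (fun n : ℕ => P {ω | ¬ ∀ θ₁ ∈ m.Θ₁, ∀ θ₂ ∈ m.Θ₂, ‖θ₁ - θ₁s‖ < η → δ ≤ ‖θ₂ - θ₂s‖ →
      m.logLik₂ n (fun j => X₂ j ω) θ₁ θ₂ ≤
        m.logLik₂ n (fun j => X₂ j ω) θ₁s θ₂s - ((n * ε : ℝ) : EReal)}) atTop (𝓝 0)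

/-- The set `B₁ × B₂ ⊆ ℝ^(d₁ + d₂)` for balls `B₁`, `B₂` of radii `r₁`, `r₂`. -/
def nbhd (θ₁s : EuclideanSpace ℝ (Fin d₁)) (θ₂s : EuclideanSpace ℝ (Fin d₂)) (r₁ r₂ : ℝ) :
    Set (EuclideanSpace ℝ (Fin d₁ ⊕ Fin d₂)) :=
  {θ | fstParam θ ∈ Metric.ball θ₁s r₁ ∧ sndParam θ ∈ Metric.ball θ₂s r₂}

/-- Smoothness of the log likelihoods on `B₁` and `B₁ × B₂`, with moment conditions on dominating
functions of the partial derivatives up to order three. -/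
structure SmoothnessCondition (m : CutModel 𝒳₁ 𝒳₂ d₁ d₂) (Q₁ : Measure 𝒳₁) (Q₂ : Measure 𝒳₂)
    (θ₁s : EuclideanSpace ℝ (Fin d₁)) (θ₂s : EuclideanSpace ℝ (Fin d₂)) (r₁ r₂ : ℝ) : Prop where
  ball_subset₁ : Metric.ball θ₁s r₁ ⊆ m.Θ₁
  ball_subset₂ : Metric.ball θ₂s r₂ ⊆ m.Θ₂
  smooth₁ : ∀ᵐ x ∂Q₁, (∀ θ₁ ∈ Metric.ball θ₁s r₁, 0 < m.f₁ θ₁ x) ∧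
    ContDiffOn ℝ 3 (m.ell₁ x) (Metric.ball θ₁s r₁)
  smooth₂ : ∀ᵐ x ∂Q₂, (∀ θ ∈ nbhd θ₁s θ₂s r₁ r₂, 0 < m.f₂ (fstParam θ) (sndParam θ) x) ∧
    ContDiffOn ℝ 3 (m.ell₂ x) (nbhd θ₁s θ₂s r₁ r₂)
  moments₁ : ∃ G₁ G₂ G₃ : 𝒳₁ → ℝ, Measurable G₁ ∧ Measurable G₂ ∧ Measurable G₃ ∧
    Integrable (fun x => G₁ x ^ 4) Q₁ ∧ Integrable (fun x => G₂ x ^ 4) Q₁ ∧ Integrable G₃ Q₁ ∧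
    ∀ᵐ x ∂Q₁, ∀ θ ∈ Metric.ball θ₁s r₁, ∀ i j k,
      |pderiv i (m.ell₁ x) θ| ≤ G₁ x ∧
      |pderiv i (pderiv j (m.ell₁ x)) θ| ≤ G₂ x ∧
      |pderiv i (pderiv j (pderiv k (m.ell₁ x))) θ| ≤ G₃ x
  moments₂ : ∃ G₄ G₅ G₆ : 𝒳₂ → ℝ, Measurable G₄ ∧ Measurable G₅ ∧ Measurable G₆ ∧
    Integrable (fun x => G₄ x ^ 4) Q₂ ∧ Integrable (fun x => G₅ x ^ 4) Q₂ ∧ Integrable G₆ Q₂ ∧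
    ∀ᵐ x ∂Q₂, ∀ θ ∈ nbhd θ₁s θ₂s r₁ r₂, ∀ i j k,
      |pderiv i (m.ell₂ x) θ| ≤ G₄ x ∧
      |pderiv i (pderiv j (m.ell₂ x)) θ| ≤ G₅ x ∧
      |pderiv i (pderiv j (pderiv k (m.ell₂ x))) θ| ≤ G₆ x

/-- Positive definiteness of the information matrices on `B₁` and `B₁ × B₂`. -/
structure PosDefCondition (m : CutModel 𝒳₁ 𝒳₂ d₁ d₂) (Q₁ : Measure 𝒳₁) (Q₂ : Measure 𝒳₂)
    (θ₁s : EuclideanSpace ℝ (Fin d₁)) (θ₂s : EuclideanSpace ℝ (Fin d₂)) (r₁ r₂ : ℝ) : Prop where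
  posDef_I₁ : ∀ θ₁ ∈ Metric.ball θ₁s r₁, (m.I₁ Q₁ θ₁).PosDef
  posDef_J₁ : ∀ θ₁ ∈ Metric.ball θ₁s r₁, (m.J₁ Q₁ θ₁).PosDef
  posDef_I₂ : ∀ θ₁ ∈ Metric.ball θ₁s r₁, ∀ θ₂ ∈ Metric.ball θ₂s r₂, (m.I₂ Q₂ θ₁ θ₂).PosDef
  posDef_J₂ : ∀ θ₁ ∈ Metric.ball θ₁s r₁, ∀ θ₂ ∈ Metric.ball θ₂s r₂, (m.J₂ Q₂ θ₁ θ₂).PosDef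

end CutModel

/-! The two stages are one Z-estimator with a stacked estimating equation: the score of module 1,
and the `θ₂`-part of the score of module 2. With probability tending to one both average scores
vanish at the estimators. Let `u` be the joint estimation error and `v` the stacked average scores
at the pseudo-true parameters. A Taylor expansion gives `v - K u = o(‖u‖)` in probability
(`SmoothLogLik.isLittleO_score`), where `K = [[J₁, 0], [Rᵀ, J₂]]`. It is block triangular because
module 1 does not see `θ₂`.

No rate for `u` is needed beforehand. Since `K` is invertible, an error that is small relative to
`u` is also small relative to `K⁻¹ v`, so `u` and `K⁻¹ v` are asymptotically equivalent, and a
Slutsky argument (`tendstoInDistribution_of_isLittleO_whp`) transfers the limit law. The two samples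
are independent, so `√n₂ v` has a Gaussian limit with block diagonal covariance `V = diag(I₁/α, I₂)`
(`tendstoInDistribution_joinParam_average`); the factor `1/α` is the limit of `n₂/n₁`. The identity
`Σ = K⁻¹ V K⁻ᵀ` (`triangularInv_sandwich`) then yields both the limit law and the positive
semidefiniteness.

The expansion is local, hence needs consistency. In stage 1 this is the separation condition. In
stage 2 the criterion is evaluated at `θ₁hat` instead of `θ₁s`, and a Lipschitz bound absorbs the
difference (`tendsto_secondStage`). -/

/-! ### Convergence in probability as convergence along a filter -/

section Whp

variable {Ω : Type*} [MeasurableSpace Ω]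

/-- The filter on `ℕ × Ω` of the events that hold with probability tending to one. A family
`Y k ω` converges to `c` in probability iff `Y` tends to `c` along this filter. -/
def whp (P : Measure Ω) : Filter (ℕ × Ω) where
  -- `P` acts here as an outer measure: the filter axioms need only monotonicity and subadditivity,
  -- so no event has to be measurable.
  sets := {s | Tendsto (fun k => P {ω | (k, ω) ∉ s}) atTop (𝓝 0)}
  univ_sets := by simp
  sets_of_superset hs hst :=
    tendsto_of_tendsto_of_tendsto_of_le_of_le tendsto_const_nhds hs (fun _ => zero_le)
      fun _ => measure_mono fun _ h h' => h (hst h')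
  inter_sets {s t} hs ht := by
    have h := Tendsto.add hs ht
    rw [add_zero] at h
    refine tendsto_of_tendsto_of_tendsto_of_le_of_le tendsto_const_nhds h (fun _ => zero_le)
      fun k => (measure_mono ?_).trans (measure_union_le _ _)
    intro ω hω
    by_contra hc
    simp only [Set.mem_union, Set.mem_ofPred_eq, not_or, not_not] at hc
    exact hω hc

variable {P : Measure Ω}

lemma eventually_whp {q : ℕ × Ω → Prop} :
    (∀ᶠ p in whp P, q p) ↔ Tendsto (fun k => P {ω | ¬ q (k, ω)}) atTop (𝓝 0) := Iff.rfl

lemma eventually_whp_of_ae {q : ℕ × Ω → Prop} (h : ∀ᵐ ω ∂P, ∀ k, q (k, ω)) :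
    ∀ᶠ p in whp P, q p := by
  rw [eventually_whp]
  have : ∀ k, P {ω | ¬ q (k, ω)} = 0 := fun k => by
    rw [← ae_iff]; filter_upwards [h] with ω hω using hω k
  simp [this]

/-- Allows facts valid for all large `k` to be combined with events of high probability. -/
lemma tendsto_fst_whp : Tendsto Prod.fst (whp P) atTop := by
  intro s hs
  change Tendsto _ _ _
  refine tendsto_const_nhds.congr' ?_
  filter_upwards [hs] with k hk
  simp [show k ∈ s from hk]

lemma tendsto_whp_zero_iff {E : Type*} [SeminormedAddCommGroup E] {Y : ℕ → Ω → E} :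
    Tendsto (fun p : ℕ × Ω => Y p.1 p.2) (whp P) (𝓝 0) ↔ TendstoInMeasure P Y atTop 0 := by
  rw [tendstoInMeasure_iff_norm, NormedAddGroup.tendsto_nhds_zero]
  simp only [eventually_whp, not_lt, Pi.zero_apply, sub_zero, gt_iff_lt]

lemma tendsto_whp_of_ae [IsFiniteMeasure P] {E : Type*} [SeminormedAddCommGroup E]
    {Y : ℕ → Ω → E} {c : E}
    (hY : ∀ k, AEStronglyMeasurable (Y k) P)
    (h : ∀ᵐ ω ∂P, Tendsto (fun k => Y k ω) atTop (𝓝 c)) :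
    Tendsto (fun p : ℕ × Ω => Y p.1 p.2) (whp P) (𝓝 c) := by
  rw [tendsto_iff_norm_sub_tendsto_zero]
  refine tendsto_whp_zero_iff (Y := fun k ω => ‖Y k ω - c‖).2 (tendstoInMeasure_of_tendsto_ae (fun k => ?_) ?_)
  · exact ((hY k).sub aestronglyMeasurable_const).norm
  · filter_upwards [h] with ω hω
    exact tendsto_iff_norm_sub_tendsto_zero.1 hω

/-- A perturbation that is negligible in probability relative to a sequence converging in
distribution does not change the limit. -/
lemma tendstoInDistribution_of_isLittleO_whp {E Ω' : Type*} [NormedAddCommGroup E]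
    [NormedSpace ℝ E] [FiniteDimensional ℝ E] [MeasurableSpace E] [BorelSpace E]
    [SecondCountableTopology E] [MeasurableSpace Ω'] {μ' : Measure Ω'} [IsProbabilityMeasure μ']
    [IsProbabilityMeasure P] {T Y : ℕ → Ω → E} {Z : Ω' → E}
    (hT : TendstoInDistribution T atTop Z (fun _ => P) μ')
    (hYT : (fun p : ℕ × Ω => Y p.1 p.2 - T p.1 p.2) =o[whp P] fun p : ℕ × Ω => T p.1 p.2)
    (hY : ∀ k, AEMeasurable (Y k) P) :
    TendstoInDistribution Y atTop Z (fun _ => P) μ' := by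
  refine tendstoInDistribution_of_tendstoInMeasure_sub Y Z hT ?_ hY
  refine tendsto_whp_zero_iff.1 ?_
  rw [NormedAddGroup.tendsto_nhds_zero]
  intro ε hε
  rw [eventually_whp, ENNReal.tendsto_nhds_zero]
  intro η hη
  have hη2 : 0 < η / 2 := ENNReal.half_pos hη.ne'
  -- Tightness of the single law of `Z` provides `K` with `P(‖Z‖ > K) < η / 2`. The closed set `{K +
  -- 1 ≤ ‖x‖}` lies inside `{K < ‖x‖}`, and the portmanteau theorem bounds its probability under `T
  -- k`.
  have htight := isTightMeasureSet_iff_tendsto_measure_norm_gt.1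
    (isTightMeasureSet_singleton (μ := μ'.map Z))
  simp only [Set.mem_singleton_iff, iSup_iSup_eq_left] at htight
  obtain ⟨K, hK, hK0⟩ := ((htight.eventually_lt_const hη2).and (eventually_gt_atTop 0)).exists
  have hcl : IsClosed {x : E | K + 1 ≤ ‖x‖} := isClosed_le continuous_const continuous_norm
  have hlim := ProbabilityMeasure.limsup_measure_closed_le_of_tendsto hT.tendsto hcl
  simp only [ProbabilityMeasure.coe_mk] at hlim
  have hZ : (μ'.map Z) {x : E | K + 1 ≤ ‖x‖} < η / 2 :=
    (measure_mono fun x (hx : K + 1 ≤ ‖x‖) => show K < ‖x‖ by linarith).trans_lt hK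
  have hev := eventually_lt_of_limsup_lt (hlim.trans_lt hZ)
  -- With this constant the perturbation is at most `ε / 2` wherever `‖T k ω‖ < K + 1`.
  have hlo := hYT.def (show 0 < ε / (K + 1) / 2 by positivity)
  rw [eventually_whp, ENNReal.tendsto_nhds_zero] at hlo
  filter_upwards [hev, hlo _ hη2] with k hk1 hk2
  rw [Measure.map_apply_of_aemeasurable (hT.forall_aemeasurable k) hcl.measurableSet] at hk1
  calc P {ω | ¬ ‖(Y - T) k ω‖ < ε}
      ≤ P ((T k ⁻¹' {x : E | K + 1 ≤ ‖x‖}) ∪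
          {ω | ¬ ‖Y k ω - T k ω‖ ≤ ε / (K + 1) / 2 * ‖T k ω‖}) := by
        refine measure_mono fun ω hω => ?_
        by_contra hc
        simp only [Set.mem_union, Set.mem_preimage, Set.mem_ofPred_eq, not_or,
          not_le] at hc
        refine hω (lt_of_le_of_lt (show ‖(Y - T) k ω‖ ≤ _ from not_lt.1 hc.2) ?_)
        calc ε / (K + 1) / 2 * ‖T k ω‖ ≤ ε / (K + 1) / 2 * (K + 1) := by
              gcongr; exact hc.1.le
          _ = ε / 2 := by field_simp
          _ < ε := by linarith
    _ ≤ η / 2 + η / 2 := (measure_union_le _ _).trans (add_le_add hk1.le hk2)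
    _ = η := ENNReal.add_halves η

end Whp

/-! ### Sample averages -/

section Sample

variable {Ω 𝒳 : Type*} [MeasurableSpace Ω] [MeasurableSpace 𝒳] {P : Measure Ω} {Q : Measure 𝒳}
  {X : ℕ → Ω → 𝒳}

/-- The `X j` are independent with law `Q`. -/
structure IsIIDSample (P : Measure Ω) (Q : Measure 𝒳) (X : ℕ → Ω → 𝒳) : Prop where
  measurable : ∀ j, Measurable (X j)
  law : ∀ j, P.map (X j) = Q
  indep : iIndepFun X P

namespace IsIIDSample

lemma isProbabilityMeasure [IsProbabilityMeasure P] (hX : IsIIDSample P Q X) :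
    IsProbabilityMeasure Q :=
  hX.law 0 ▸ Measure.isProbabilityMeasure_map (hX.measurable 0).aemeasurable

lemma ae_forall (hX : IsIIDSample P Q X) {q : 𝒳 → Prop} (h : ∀ᵐ x ∂Q, q x) :
    ∀ᵐ ω ∂P, ∀ j, q (X j ω) :=
  ae_all_iff.2 fun j =>
    ae_of_ae_map (hX.measurable j).aemeasurable (by rw [hX.law j]; exact h)

lemma eventually_whp (hX : IsIIDSample P Q X) {q : 𝒳 → Prop} (h : ∀ᵐ x ∂Q, q x) :
    ∀ᶠ p in whp P, ∀ j, q (X j p.2) :=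
  eventually_whp_of_ae (by filter_upwards [hX.ae_forall h] with ω hω _ using hω)

lemma identDistrib (hX : IsIIDSample P Q X) {g : 𝒳 → ℝ} (hg : Measurable g) (i j : ℕ) :
    IdentDistrib (fun ω => g (X i ω)) (fun ω => g (X j ω)) P P :=
  IdentDistrib.comp ⟨(hX.measurable i).aemeasurable, (hX.measurable j).aemeasurable,
    by rw [hX.law, hX.law]⟩ hg

lemma integral_comp (hX : IsIIDSample P Q X) {g : 𝒳 → ℝ} (hg : AEStronglyMeasurable g Q) (j : ℕ) :
    ∫ ω, g (X j ω) ∂P = ∫ x, g x ∂Q := by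
  rw [← integral_map (hX.measurable j).aemeasurable (by rwa [hX.law j]), hX.law j]

/-- The law of large numbers along a sequence of sample sizes. -/
lemma tendsto_average [IsProbabilityMeasure P] (hX : IsIIDSample P Q X) {g : 𝒳 → ℝ}
    (hg : Integrable g Q) {n : ℕ → ℕ} (hn : Tendsto n atTop atTop) :
    Tendsto (fun p : ℕ × Ω => (n p.1 : ℝ)⁻¹ * ∑ j ∈ Finset.range (n p.1), g (X j p.2))
      (whp P) (𝓝 (∫ x, g x ∂Q)) := by
  -- Independence and equality of laws pass to `g' (X j)` for a measurable representative `g'`;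
  -- almost surely the averages of `g` and `g'` coincide.
  obtain ⟨g', hg', hgg'⟩ := hg.1
  have hmeas : Measurable g' := hg'.measurable
  have hint : Integrable (fun ω => g' (X 0 ω)) P := by
    have h : Integrable g' (P.map (X 0)) := by rw [hX.law 0]; exact hg.congr hgg'
    exact h.comp_measurable (hX.measurable 0)
  have hlln := strong_law_ae_real (fun j ω => g' (X j ω)) hint
    (fun i j hij => (hX.indep.indepFun hij).comp hmeas hmeas)
    (fun i => hX.identDistrib hmeas i 0)
  rw [hX.integral_comp hg'.aestronglyMeasurable 0, ← integral_congr_ae hgg'] at hlln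
  refine tendsto_whp_of_ae (Y := fun k ω => (n k : ℝ)⁻¹ * ∑ j ∈ Finset.range (n k), g (X j ω))
    (fun k => ?_) ?_
  · refine (Finset.aestronglyMeasurable_fun_sum _ fun j _ => ?_).const_mul _
    exact AEStronglyMeasurable.comp_measurable (by rw [hX.law j]; exact hg.1) (hX.measurable j)
  · filter_upwards [hlln, hX.ae_forall hgg'] with ω hω hω'
    refine (hω.comp hn).congr fun k => ?_
    simp [hω', div_eq_inv_mul]

end IsIIDSample

end Sample

/-! ### Partial derivatives -/

section Calculus

variable {ι : Type*} [Fintype ι] [DecidableEq ι]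

lemma clm_apply_eq_sum (L : EuclideanSpace ℝ ι →L[ℝ] ℝ) (v : EuclideanSpace ℝ ι) :
    L v = ∑ i, v i * L (EuclideanSpace.single i 1) := by
  conv_lhs => rw [← (EuclideanSpace.basisFun ι ℝ).sum_repr v]
  simp

lemma norm_clm_le_sum (L : EuclideanSpace ℝ ι →L[ℝ] ℝ) :
    ‖L‖ ≤ ∑ i, |L (EuclideanSpace.single i 1)| := by
  refine L.opNorm_le_bound (Finset.sum_nonneg fun _ _ => abs_nonneg _) fun v => ?_
  rw [clm_apply_eq_sum L v, Finset.sum_mul]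
  refine (norm_sum_le _ _).trans (Finset.sum_le_sum fun i _ => ?_)
  rw [norm_mul, mul_comm]
  exact mul_le_mul_of_nonneg_left (PiLp.norm_apply_le v i) (abs_nonneg _)

lemma fderiv_apply_eq_sum_pderiv (f : EuclideanSpace ℝ ι → ℝ) (x v : EuclideanSpace ℝ ι) :
    fderiv ℝ f x v = ∑ i, v i * pderiv i f x :=
  clm_apply_eq_sum _ v

lemma abs_sub_le_of_abs_pderiv_le {f : EuclideanSpace ℝ ι → ℝ} {s : Set (EuclideanSpace ℝ ι)}
    {G : ℝ} (hs : Convex ℝ s) (hf : ∀ x ∈ s, DifferentiableAt ℝ f x)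
    (hb : ∀ x ∈ s, ∀ i, |pderiv i f x| ≤ G) {x y : EuclideanSpace ℝ ι} (hx : x ∈ s) (hy : y ∈ s) :
    |f y - f x| ≤ Fintype.card ι * G * ‖y - x‖ := by
  refine hs.norm_image_sub_le_of_norm_fderiv_le hf (fun z hz => ?_) hx hy
  refine (norm_clm_le_sum _).trans ((Finset.sum_le_sum fun i _ => hb z hz i).trans ?_)
  simp

/-- Mean value inequality for `f` minus its linear part, on the closed ball around `θs` through `θ`.
There each partial derivative moves by at most `card ι * G * ‖θ - θs‖`, and summing over the
coordinates gives the second factor `card ι`. -/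
lemma abs_taylor_le {f : EuclideanSpace ℝ ι → ℝ} {θs : EuclideanSpace ℝ ι} {r G : ℝ}
    (hf : ∀ x ∈ Metric.ball θs r, DifferentiableAt ℝ f x)
    (hp : ∀ k, ∀ x ∈ Metric.ball θs r, DifferentiableAt ℝ (pderiv k f) x)
    (hb : ∀ x ∈ Metric.ball θs r, ∀ l k, |pderiv l (pderiv k f) x| ≤ G) (hG : 0 ≤ G)
    {θ : EuclideanSpace ℝ ι} (hθ : θ ∈ Metric.ball θs r) :
    |f θ - f θs - ∑ k, (θ - θs) k * pderiv k f θs| ≤ Fintype.card ι ^ 2 * G * ‖θ - θs‖ ^ 2 := by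
  have hsub : Metric.closedBall θs ‖θ - θs‖ ⊆ Metric.ball θs r :=
    Metric.closedBall_subset_ball (by rwa [← dist_eq_norm])
  have hs : θs ∈ Metric.closedBall θs ‖θ - θs‖ := Metric.mem_closedBall_self (norm_nonneg _)
  have h := (convex_closedBall θs ‖θ - θs‖).norm_image_sub_le_of_norm_fderiv_le'
    (φ := fderiv ℝ f θs) (C := Fintype.card ι ^ 2 * G * ‖θ - θs‖) (fun x hx => hf x (hsub hx))
    (fun x hx => ?_) hs (show θ ∈ _ by rw [Metric.mem_closedBall, dist_eq_norm])
  · rw [fderiv_apply_eq_sum_pderiv, Real.norm_eq_abs] at h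
    rwa [pow_two ‖θ - θs‖, ← mul_assoc]
  · refine (norm_clm_le_sum _).trans ?_
    calc ∑ k, |(fderiv ℝ f x - fderiv ℝ f θs) (EuclideanSpace.single k 1)|
        ≤ ∑ _k : ι, Fintype.card ι * G * ‖θ - θs‖ := by
          refine Finset.sum_le_sum fun k _ => ?_
          refine (abs_sub_le_of_abs_pderiv_le (f := pderiv k f) (convex_ball θs r) (hp k)
            (fun z hz l => hb z hz l k) (hsub hs) (hsub hx)).trans ?_
          have : ‖x - θs‖ ≤ ‖θ - θs‖ := by simpa [dist_eq_norm] using hx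
          gcongr
      _ = Fintype.card ι ^ 2 * G * ‖θ - θs‖ := by simp; ring

lemma ContDiffOn.pderiv {f : EuclideanSpace ℝ ι → ℝ} {U : Set (EuclideanSpace ℝ ι)}
    {m n : WithTop ℕ∞} (hf : ContDiffOn ℝ n f U) (hU : IsOpen U) (hmn : m + 1 ≤ n) (i : ι) :
    ContDiffOn ℝ m (pderiv i f) U :=
  (hf.fderiv_of_isOpen hU hmn).clm_apply contDiffOn_const

lemma hasDerivAt_line {f : EuclideanSpace ℝ ι → ℝ} {θ : EuclideanSpace ℝ ι} {t : ℝ} (i : ι)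
    (hf : DifferentiableAt ℝ f (θ + t • EuclideanSpace.single i (1 : ℝ))) :
    HasDerivAt (fun s : ℝ => f (θ + s • EuclideanSpace.single i (1 : ℝ)))
      (pderiv i f (θ + t • EuclideanSpace.single i (1 : ℝ))) t := by
  have h : HasDerivAt (fun s : ℝ => θ + s • EuclideanSpace.single i (1 : ℝ))
      (EuclideanSpace.single i (1 : ℝ)) t := by
    simpa using ((hasDerivAt_id t).smul_const (EuclideanSpace.single i (1 : ℝ))).const_add θ
  exact hf.hasFDerivAt.comp_hasDerivAt t h

lemma tendsto_line (θ : EuclideanSpace ℝ ι) (i : ι) :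
    Tendsto (fun s : ℝ => θ + s • EuclideanSpace.single i (1 : ℝ)) (𝓝 0) (𝓝 θ) := by
  have h : Continuous fun s : ℝ => θ + s • EuclideanSpace.single i (1 : ℝ) := by fun_prop
  simpa using h.tendsto 0

/-- A maximum along a single coordinate line is all that the second stage offers: there `θ₁` is
frozen and only the `θ₂` directions are optimized. -/
lemma pderiv_eq_zero_of_isLocalMax_line {f : EuclideanSpace ℝ ι → ℝ} {θ : EuclideanSpace ℝ ι}
    (i : ι) (hf : DifferentiableAt ℝ f θ)
    (hmax : IsLocalMax (fun s : ℝ => f (θ + s • EuclideanSpace.single i (1 : ℝ))) 0) :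
    pderiv i f θ = 0 := by
  have h := hasDerivAt_line (f := f) (θ := θ) (t := 0) i (by simpa using hf)
  simpa using hmax.hasDerivAt_eq_zero h

lemma pderiv_sum {α : Type*} (s : Finset α) {f : α → EuclideanSpace ℝ ι → ℝ}
    {θ : EuclideanSpace ℝ ι} (i : ι) (hf : ∀ a ∈ s, DifferentiableAt ℝ (f a) θ) :
    pderiv i (fun θ => ∑ a ∈ s, f a θ) θ = ∑ a ∈ s, pderiv i (f a) θ := by
  simp only [_root_.pderiv]
  rw [fderiv_fun_sum hf]
  simp

/-- The derivative is an almost everywhere limit of difference quotients, which are measurable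
because `g` is so at each fixed parameter in `U`. -/
lemma aemeasurable_pderiv {𝒳 : Type*} [MeasurableSpace 𝒳] {Q : Measure 𝒳}
    {g : 𝒳 → EuclideanSpace ℝ ι → ℝ} {U : Set (EuclideanSpace ℝ ι)} (hU : IsOpen U)
    (hg : ∀ θ ∈ U, AEMeasurable (fun x => g x θ) Q) {θ : EuclideanSpace ℝ ι} (hθ : θ ∈ U) (i : ι)
    (hd : ∀ᵐ x ∂Q, DifferentiableAt ℝ (g x) θ) :
    AEMeasurable (fun x => pderiv i (g x) θ) Q := by
  have hu : Tendsto (fun n : ℕ => 1 / ((n : ℝ) + 1)) atTop (𝓝 0) :=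
    tendsto_one_div_add_atTop_nhds_zero_nat
  obtain ⟨N, hN⟩ := eventually_atTop.1
    (((tendsto_line θ i).comp hu).eventually (hU.mem_nhds hθ))
  -- The shift by `N` keeps every evaluation point inside `U`.
  let u : ℕ → ℝ := fun n => 1 / (((n + N : ℕ) : ℝ) + 1)
  have hu' : Tendsto u atTop (𝓝[≠] 0) := by
    refine tendsto_nhdsWithin_iff.2 ⟨hu.comp (tendsto_add_atTop_nat N), Eventually.of_forall ?_⟩
    intro n
    have : (0 : ℝ) < u n := by positivity
    exact this.ne'
  refine aemeasurable_of_tendsto_metrizable_ae' (f := fun n x =>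
    (u n)⁻¹ * (g x (θ + u n • EuclideanSpace.single i (1 : ℝ)) - g x θ)) (fun n => ?_) ?_
  · exact ((hg _ (hN (n + N) (by simp))).sub (hg _ hθ)).const_mul _
  · filter_upwards [hd] with x hx
    have h := (hasDerivAt_line (f := g x) (θ := θ) (t := 0) i
      (by simpa using hx)).tendsto_slope_zero.comp hu'
    simpa [Function.comp_def] using h

end Calculus

/-! ### Smooth log likelihoods -/

section Smooth

variable {Ω 𝒳 : Type*} [MeasurableSpace Ω] [MeasurableSpace 𝒳] {P : Measure Ω} {Q : Measure 𝒳}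
  {ι : Type*} [Fintype ι] [DecidableEq ι]

/-- A log likelihood that is smooth on a ball around `θs`, with dominated partial derivatives. -/
structure SmoothLogLik (Q : Measure 𝒳) (ℓ : 𝒳 → EuclideanSpace ℝ ι → ℝ) (θs : EuclideanSpace ℝ ι)
    (r : ℝ) (G₁ G₂ G₃ : 𝒳 → ℝ) : Prop where
  radius_pos : 0 < r
  aemeasurable : ∀ θ ∈ Metric.ball θs r, AEMeasurable (fun x => ℓ x θ) Q
  contDiffOn : ∀ᵐ x ∂Q, ContDiffOn ℝ 3 (ℓ x) (Metric.ball θs r)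
  nonneg : ∀ x, 0 ≤ G₁ x ∧ 0 ≤ G₂ x ∧ 0 ≤ G₃ x
  memLp : MemLp G₁ 2 Q
  integrable₂ : Integrable G₂ Q
  integrable₃ : Integrable G₃ Q
  bound : ∀ᵐ x ∂Q, ∀ θ ∈ Metric.ball θs r, ∀ i j k,
    |pderiv i (ℓ x) θ| ≤ G₁ x ∧ |pderiv i (pderiv j (ℓ x)) θ| ≤ G₂ x ∧
      |pderiv i (pderiv j (pderiv k (ℓ x))) θ| ≤ G₃ x

namespace SmoothLogLik

variable {ℓ : 𝒳 → EuclideanSpace ℝ ι → ℝ} {θs : EuclideanSpace ℝ ι} {r : ℝ} {G₁ G₂ G₃ : 𝒳 → ℝ}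

lemma mem_ball (h : SmoothLogLik Q ℓ θs r G₁ G₂ G₃) : θs ∈ Metric.ball θs r :=
  Metric.mem_ball_self h.radius_pos

lemma differentiableAt (h : SmoothLogLik Q ℓ θs r G₁ G₂ G₃) :
    ∀ᵐ x ∂Q, ∀ θ ∈ Metric.ball θs r, DifferentiableAt ℝ (ℓ x) θ := by
  filter_upwards [h.contDiffOn] with x hx θ hθ
  exact (hx.differentiableOn (by norm_num)).differentiableAt (Metric.isOpen_ball.mem_nhds hθ)

lemma differentiableAt_pderiv (h : SmoothLogLik Q ℓ θs r G₁ G₂ G₃) :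
    ∀ᵐ x ∂Q, ∀ θ ∈ Metric.ball θs r, ∀ i, DifferentiableAt ℝ (pderiv i (ℓ x)) θ := by
  filter_upwards [h.contDiffOn] with x hx θ hθ i
  exact ((hx.pderiv (m := 2) Metric.isOpen_ball (by norm_num) i).differentiableOn
    (by norm_num)).differentiableAt (Metric.isOpen_ball.mem_nhds hθ)

lemma differentiableAt_pderiv_pderiv (h : SmoothLogLik Q ℓ θs r G₁ G₂ G₃) :
    ∀ᵐ x ∂Q, ∀ θ ∈ Metric.ball θs r, ∀ i j,
      DifferentiableAt ℝ (pderiv i (pderiv j (ℓ x))) θ := by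
  filter_upwards [h.contDiffOn] with x hx θ hθ i j
  exact (((hx.pderiv (m := 2) Metric.isOpen_ball (by norm_num) j).pderiv (m := 1)
    Metric.isOpen_ball (by norm_num) i).differentiableOn
    (by norm_num)).differentiableAt (Metric.isOpen_ball.mem_nhds hθ)

lemma aemeasurable_score (h : SmoothLogLik Q ℓ θs r G₁ G₂ G₃) {θ : EuclideanSpace ℝ ι}
    (hθ : θ ∈ Metric.ball θs r) (i : ι) : AEMeasurable (fun x => pderiv i (ℓ x) θ) Q :=
  aemeasurable_pderiv Metric.isOpen_ball h.aemeasurable hθ i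
    (h.differentiableAt.mono fun _ hx => hx θ hθ)

lemma memLp_score (h : SmoothLogLik Q ℓ θs r G₁ G₂ G₃) (i : ι) :
    MemLp (fun x => pderiv i (ℓ x) θs) 2 Q := by
  refine h.memLp.mono (h.aemeasurable_score h.mem_ball i).aestronglyMeasurable ?_
  filter_upwards [h.bound] with x hx
  rw [Real.norm_eq_abs, Real.norm_eq_abs, abs_of_nonneg (h.nonneg x).1]
  exact (hx θs h.mem_ball i i i).1

lemma integrable_pderiv_pderiv (h : SmoothLogLik Q ℓ θs r G₁ G₂ G₃) (i j : ι) :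
    Integrable (fun x => pderiv i (pderiv j (ℓ x)) θs) Q := by
  refine h.integrable₂.mono (aemeasurable_pderiv (g := fun x => pderiv j (ℓ x)) Metric.isOpen_ball
    (fun θ hθ => h.aemeasurable_score hθ j) h.mem_ball i
    (h.differentiableAt_pderiv.mono fun x hx => hx θs h.mem_ball j)).aestronglyMeasurable ?_
  filter_upwards [h.bound] with x hx
  rw [Real.norm_eq_abs, Real.norm_eq_abs, abs_of_nonneg (h.nonneg x).2.1]
  exact (hx θs h.mem_ball i j i).2.1

/-- The expected score vanishes in every direction in which `θs` maximizes the expected log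
likelihood. -/
lemma integral_score_eq_zero [IsFiniteMeasure Q] (h : SmoothLogLik Q ℓ θs r G₁ G₂ G₃)
    (hint : Integrable (fun x => ℓ x θs) Q) (i : ι)
    (hmax : IsLocalMax (fun s : ℝ => ∫ x, ℓ x (θs + s • EuclideanSpace.single i (1 : ℝ)) ∂Q) 0) :
    ∫ x, pderiv i (ℓ x) θs ∂Q = 0 := by
  have hnhds : (fun s : ℝ => θs + s • EuclideanSpace.single i (1 : ℝ)) ⁻¹' Metric.ball θs r ∈ 𝓝 0 :=
    tendsto_line θs i (Metric.isOpen_ball.mem_nhds h.mem_ball)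
  -- Differentiation under the integral sign, dominated by `G₁`: the slope of the expected log
  -- likelihood along the line is the expected score.
  have hd := (hasDerivAt_integral_of_dominated_loc_of_deriv_le (μ := Q) (bound := G₁)
    (F := fun (s : ℝ) x => ℓ x (θs + s • EuclideanSpace.single i (1 : ℝ)))
    (F' := fun (s : ℝ) x => pderiv i (ℓ x) (θs + s • EuclideanSpace.single i (1 : ℝ)))
    hnhds ?_ (by simpa using hint) ?_ ?_ (h.memLp.integrable (by norm_num)) ?_).2
  · simpa using hmax.hasDerivAt_eq_zero hd
  · filter_upwards [hnhds] with s hs using (h.aemeasurable _ hs).aestronglyMeasurable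
  · simpa using (h.aemeasurable_score h.mem_ball i).aestronglyMeasurable
  · filter_upwards [h.bound] with x hx s hs using (hx _ hs i i i).1
  · filter_upwards [h.differentiableAt] with x hx s hs using hasDerivAt_line i (hx _ hs)

lemma abs_sub_le (h : SmoothLogLik Q ℓ θs r G₁ G₂ G₃) :
    ∀ᵐ x ∂Q, ∀ θ ∈ Metric.ball θs r, ∀ θ' ∈ Metric.ball θs r,
      |ℓ x θ' - ℓ x θ| ≤ Fintype.card ι * G₁ x * ‖θ' - θ‖ := by
  filter_upwards [h.bound, h.differentiableAt] with x hb hd θ hθ θ' hθ'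
  exact abs_sub_le_of_abs_pderiv_le (convex_ball θs r) hd (fun z hz i => (hb z hz i i i).1) hθ hθ'

lemma abs_score_taylor_le (h : SmoothLogLik Q ℓ θs r G₁ G₂ G₃) :
    ∀ᵐ x ∂Q, ∀ θ ∈ Metric.ball θs r, ∀ i,
      |pderiv i (ℓ x) θ - pderiv i (ℓ x) θs -
        ∑ k, (θ - θs) k * pderiv k (pderiv i (ℓ x)) θs| ≤
          Fintype.card ι ^ 2 * G₃ x * ‖θ - θs‖ ^ 2 := by
  filter_upwards [h.bound, h.differentiableAt_pderiv, h.differentiableAt_pderiv_pderiv]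
    with x hb hd hdd θ hθ i
  exact abs_taylor_le (fun z hz => hd z hz i) (fun k z hz => hdd z hz k i)
    (fun z hz l k => (hb z hz l k i).2.2) (h.nonneg x).2.2 hθ

/-- Linearization of an estimating equation at a consistent estimator. -/
lemma isLittleO_score [IsProbabilityMeasure P] (h : SmoothLogLik Q ℓ θs r G₁ G₂ G₃)
    {X : ℕ → Ω → 𝒳} (hX : IsIIDSample P Q X) {n : ℕ → ℕ} (hn : Tendsto n atTop atTop)
    {θhat : ℕ × Ω → EuclideanSpace ℝ ι} (hθ : Tendsto θhat (whp P) (𝓝 θs)) (i : ι)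
    (hzero : ∀ᶠ p in whp P, ∑ j ∈ Finset.range (n p.1), pderiv i (ℓ (X j p.2)) (θhat p) = 0) :
    (fun p : ℕ × Ω => (n p.1 : ℝ)⁻¹ * ∑ j ∈ Finset.range (n p.1), pderiv i (ℓ (X j p.2)) θs -
      ∑ l, (θhat p - θs) l * negHessianMatrix Q ℓ θs l i) =o[whp P]
        fun p => θhat p - θs := by
  set u : ℕ × Ω → EuclideanSpace ℝ ι := fun p => θhat p - θs
  set A : ι → ℕ × Ω → ℝ := fun l p =>
    (n p.1 : ℝ)⁻¹ * ∑ j ∈ Finset.range (n p.1), pderiv l (pderiv i (ℓ (X j p.2))) θs with hA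
  set B : ℕ × Ω → ℝ := fun p =>
    (n p.1 : ℝ)⁻¹ * ∑ j ∈ Finset.range (n p.1), G₃ (X j p.2) with hB
  -- The two error sources, divided by `‖u‖`: the average Hessian `A` differs from its limit
  -- `-negHessianMatrix` (law of large numbers), and the Taylor remainder is quadratic in `u` with a
  -- convergent coefficient.
  set ε : ℕ × Ω → ℝ := fun p =>
    ∑ l, |A l p + negHessianMatrix Q ℓ θs l i| + Fintype.card ι ^ 2 * B p * ‖u p‖ with hε
  have hu : Tendsto u (whp P) (𝓝 0) := by simpa [u] using hθ.sub_const θs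
  have hεlim : Tendsto ε (whp P) (𝓝 0) := by
    have h1 : ∀ l, Tendsto (fun p => |A l p + negHessianMatrix Q ℓ θs l i|) (whp P) (𝓝 0) := by
      intro l
      have := ((hX.tendsto_average (h.integrable_pderiv_pderiv l i) hn).add_const
        (negHessianMatrix Q ℓ θs l i)).abs
      simpa [negHessianMatrix] using this
    have h2 := ((hX.tendsto_average h.integrable₃ hn).const_mul
      ((Fintype.card ι : ℝ) ^ 2)).mul hu.norm
    simpa using (tendsto_finsetSum Finset.univ fun l _ => h1 l).add h2
  have hbig : (fun p : ℕ × Ω =>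
      (n p.1 : ℝ)⁻¹ * ∑ j ∈ Finset.range (n p.1), pderiv i (ℓ (X j p.2)) θs -
        ∑ l, u p l * negHessianMatrix Q ℓ θs l i) =O[whp P] fun p => ε p * ‖u p‖ := by
    refine Asymptotics.IsBigO.of_bound 1 ?_
    filter_upwards [hzero, hX.eventually_whp h.abs_score_taylor_le,
      hθ.eventually (Metric.isOpen_ball.mem_nhds h.mem_ball)] with p hp htay hball
    have hsum : |∑ j ∈ Finset.range (n p.1), (pderiv i (ℓ (X j p.2)) (θhat p) -
        pderiv i (ℓ (X j p.2)) θs - ∑ k, u p k * pderiv k (pderiv i (ℓ (X j p.2))) θs)| ≤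
        ∑ j ∈ Finset.range (n p.1), Fintype.card ι ^ 2 * G₃ (X j p.2) * ‖u p‖ ^ 2 :=
      (Finset.abs_sum_le_sum_abs _ _).trans
        (Finset.sum_le_sum fun j _ => htay j (θhat p) hball i)
    have hn0 : (0 : ℝ) ≤ (n p.1 : ℝ)⁻¹ := by positivity
    -- The score sum at `θhat` is zero, so averaging the Taylor bounds leaves only the score at `θs`
    -- and the Hessian term.
    have hkey : |(n p.1 : ℝ)⁻¹ * ∑ j ∈ Finset.range (n p.1), pderiv i (ℓ (X j p.2)) θs +
        ∑ k, u p k * A k p| ≤ Fintype.card ι ^ 2 * B p * ‖u p‖ ^ 2 := by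
      have h3 := mul_le_mul_of_nonneg_left hsum hn0
      rw [← abs_of_nonneg hn0, ← abs_mul, abs_of_nonneg hn0, Finset.sum_sub_distrib,
        Finset.sum_sub_distrib, hp, Finset.sum_comm] at h3
      have hl : (n p.1 : ℝ)⁻¹ * ∑ j ∈ Finset.range (n p.1), pderiv i (ℓ (X j p.2)) θs +
          ∑ k, u p k * A k p = -((n p.1 : ℝ)⁻¹ *
            (0 - ∑ j ∈ Finset.range (n p.1), pderiv i (ℓ (X j p.2)) θs -
              ∑ k, ∑ j ∈ Finset.range (n p.1), u p k * pderiv k (pderiv i (ℓ (X j p.2))) θs)) := by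
        have : ∑ k, u p k * A k p = (n p.1 : ℝ)⁻¹ *
            ∑ k, ∑ j ∈ Finset.range (n p.1), u p k * pderiv k (pderiv i (ℓ (X j p.2))) θs := by
          simp only [hA, Finset.mul_sum]
          exact Finset.sum_congr rfl fun k _ => Finset.sum_congr rfl fun j _ => by ring
        rw [this]; ring
      have hr : (Fintype.card ι : ℝ) ^ 2 * B p * ‖u p‖ ^ 2 = (n p.1 : ℝ)⁻¹ *
          ∑ j ∈ Finset.range (n p.1), Fintype.card ι ^ 2 * G₃ (X j p.2) * ‖u p‖ ^ 2 := by
        rw [← Finset.sum_mul, ← Finset.mul_sum]; simp only [hB]; ring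
      rwa [hl, abs_neg, hr]
    have hsecond : |∑ l, u p l * (A l p + negHessianMatrix Q ℓ θs l i)| ≤
        (∑ l, |A l p + negHessianMatrix Q ℓ θs l i|) * ‖u p‖ := by
      rw [Finset.sum_mul]
      refine (Finset.abs_sum_le_sum_abs _ _).trans (Finset.sum_le_sum fun l _ => ?_)
      rw [abs_mul, mul_comm]
      exact mul_le_mul_of_nonneg_left (PiLp.norm_apply_le (u p) l) (abs_nonneg _)
    have hsplit : (n p.1 : ℝ)⁻¹ * ∑ j ∈ Finset.range (n p.1), pderiv i (ℓ (X j p.2)) θs -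
        ∑ l, u p l * negHessianMatrix Q ℓ θs l i =
        ((n p.1 : ℝ)⁻¹ * ∑ j ∈ Finset.range (n p.1), pderiv i (ℓ (X j p.2)) θs +
          ∑ k, u p k * A k p) - ∑ l, u p l * (A l p + negHessianMatrix Q ℓ θs l i) := by
      simp only [mul_add, Finset.sum_add_distrib]; ring
    rw [one_mul, Real.norm_eq_abs, Real.norm_eq_abs]
    refine le_trans ?_ (le_abs_self _)
    rw [hsplit]
    calc _ ≤ _ := abs_sub _ _
      _ ≤ Fintype.card ι ^ 2 * B p * ‖u p‖ ^ 2 +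
          (∑ l, |A l p + negHessianMatrix Q ℓ θs l i|) * ‖u p‖ := add_le_add hkey hsecond
      _ = ε p * ‖u p‖ := by simp only [hε]; ring
  refine hbig.trans_isLittleO ?_
  have := ((Asymptotics.isLittleO_one_iff ℝ).2 hεlim).mul_isBigO
    (Asymptotics.isBigO_refl (fun p => ‖u p‖) (whp P))
  simpa using this

end SmoothLogLik

end Smooth

/-! ### Central limit theorem for two independent samples -/

section CLT

/-- Convergence in distribution sees the limit variable only through its law, so a linear image of a
Gaussian may be replaced by the identity under the image Gaussian. -/
lemma MeasureTheory.TendstoInDistribution.of_map_eq {E Ω' Ω'' κ : Type*} {Ω : κ → Type*}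
    {mΩ : ∀ i, MeasurableSpace (Ω i)} [TopologicalSpace E] [MeasurableSpace E]
    [OpensMeasurableSpace E] [MeasurableSpace Ω'] [MeasurableSpace Ω'']
    {μ : ∀ i, Measure (Ω i)} [∀ i, IsProbabilityMeasure (μ i)] {μ' : Measure Ω'}
    [IsProbabilityMeasure μ'] {μ'' : Measure Ω''} [IsProbabilityMeasure μ'']
    {X : ∀ i, Ω i → E} {l : Filter κ} {Z : Ω' → E} {Z' : Ω'' → E}
    (h : TendstoInDistribution X l Z μ μ') (hZ' : AEMeasurable Z' μ'')
    (heq : μ'.map Z = μ''.map Z') : TendstoInDistribution X l Z' μ μ'' where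
  forall_aemeasurable := h.forall_aemeasurable
  aemeasurable_limit := hZ'
  tendsto := by
    have hlim : (⟨μ''.map Z', Measure.isProbabilityMeasure_map hZ'⟩ : ProbabilityMeasure E) =
        ⟨μ'.map Z, Measure.isProbabilityMeasure_map h.aemeasurable_limit⟩ :=
      Subtype.ext heq.symm
    rw [hlim]
    exact h.tendsto

variable {Ω : Type*} [MeasurableSpace Ω] {P : Measure Ω} [IsProbabilityMeasure P]

/-- One-dimensional central limit theorem for each sample, with a convergent deterministic factor `c
k`. The argument `1` suffices because `h` will be the projection of a score on an arbitrary
direction. The variance may be zero. -/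
lemma IsIIDSample.tendsto_charFun_scaled_sum {𝒳 : Type*} [MeasurableSpace 𝒳] {Q : Measure 𝒳}
    {X : ℕ → Ω → 𝒳} (hX : IsIIDSample P Q X) {h : 𝒳 → ℝ} (hh : Measurable h) (hL : MemLp h 2 Q)
    (h0 : ∫ x, h x ∂Q = 0) {n : ℕ → ℕ} (hn : Tendsto n atTop atTop) {c : ℕ → ℝ} {c₀ : ℝ}
    (hc : Tendsto c atTop (𝓝 c₀)) :
    Tendsto (fun k => charFun (P.map fun ω =>
        c k * ((√(n k : ℝ))⁻¹ * ∑ j ∈ Finset.range (n k), h (X j ω))) 1) atTop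
      (𝓝 (Complex.exp (-((c₀ ^ 2 * ∫ x, h x ^ 2 ∂Q : ℝ) : ℂ) / 2))) := by
  have := hX.isProbabilityMeasure
  have hmeas : ∀ j, Measurable fun ω => h (X j ω) := fun j => hh.comp (hX.measurable j)
  have hL0 : MemLp (fun ω => h (X 0 ω)) 2 P :=
    MemLp.comp_of_map (by rw [hX.law 0]; exact hL) (hX.measurable 0).aemeasurable
  have hvar : Var[fun ω => h (X 0 ω); P] = ∫ x, h x ^ 2 ∂Q := by
    rw [variance_of_integral_eq_zero (hmeas 0).aemeasurable
      (by rw [hX.integral_comp hL.1 0, h0])]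
    exact hX.integral_comp (g := fun x => h x ^ 2) (hh.pow_const 2).aestronglyMeasurable 0
  have hclt := tendstoInDistribution_inv_sqrt_mul_sum_sub (P := P)
    (X := fun j ω => h (X j ω)) (P' := gaussianReal 0 Var[fun ω => h (X 0 ω); P].toNNReal)
    (Y := id) HasLaw.id hL0 (hX.indep.comp (fun _ => h) fun _ => hh)
    (fun i => hX.identDistrib hh i 0)
  simp only [hX.integral_comp hL.1 0, h0, mul_zero, sub_zero, hvar] at hclt
  have hsub : TendstoInDistribution
      (fun (k : ℕ) ω => (√(n k : ℝ))⁻¹ * ∑ j ∈ Finset.range (n k), h (X j ω)) atTop id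
      (fun _ => P) (gaussianReal 0 (∫ x, h x ^ 2 ∂Q).toNNReal) :=
    ⟨fun k => hclt.forall_aemeasurable (n k), hclt.aemeasurable_limit, hclt.tendsto.comp hn⟩
  have hconst : TendstoInMeasure P (fun k (_ : Ω) => c k) atTop fun _ => c₀ :=
    tendstoInMeasure_of_tendsto_ae (fun _ => aestronglyMeasurable_const) (ae_of_all _ fun _ => hc)
  have hprod := hsub.continuous_comp_prodMk_of_tendstoInMeasure_const
    (g := fun x : ℝ × ℝ => x.2 * x.1) (by fun_prop) hconst (fun _ => aemeasurable_const)
  have hlim := ProbabilityMeasure.tendsto_iff_tendsto_charFun.1 hprod.tendsto 1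
  simp only [ProbabilityMeasure.coe_mk] at hlim
  convert hlim using 2
  simp only [id_eq]
  rw [gaussianReal_map_const_mul, charFun_gaussianReal]
  have hnn : 0 ≤ ∫ x, h x ^ 2 ∂Q := integral_nonneg fun x => sq_nonneg _
  simp [hnn, neg_div]

variable {𝒳₁ 𝒳₂ : Type*} [MeasurableSpace 𝒳₁] [MeasurableSpace 𝒳₂] {d₁ d₂ : ℕ}
  {Q₁ : Measure 𝒳₁} {Q₂ : Measure 𝒳₂} {X₁ : ℕ → Ω → 𝒳₁} {X₂ : ℕ → Ω → 𝒳₂}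

lemma inner_joinParam (a : EuclideanSpace ℝ (Fin d₁)) (b : EuclideanSpace ℝ (Fin d₂))
    (t : EuclideanSpace ℝ (Fin d₁ ⊕ Fin d₂)) :
    inner ℝ (joinParam a b) t = inner ℝ a (fstParam t) + inner ℝ b (sndParam t) := by
  simp [PiLp.inner_apply, joinParam, fstParam, sndParam]

/-- The second moment matrix of a random vector. -/
noncomputable def secondMoment {𝒳 ι : Type*} [MeasurableSpace 𝒳] [Fintype ι] (Q : Measure 𝒳)
    (g : 𝒳 → EuclideanSpace ℝ ι) : Matrix ι ι ℝ :=
  Matrix.of fun i j => ∫ x, g x i * g x j ∂Q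

lemma integral_inner_sq {𝒳 ι : Type*} [MeasurableSpace 𝒳] [Fintype ι] {Q : Measure 𝒳}
    {g : 𝒳 → EuclideanSpace ℝ ι} (hg : ∀ i, MemLp (fun x => g x i) 2 Q)
    (t : EuclideanSpace ℝ ι) :
    ∫ x, inner ℝ (g x) t ^ 2 ∂Q = t.ofLp ⬝ᵥ (secondMoment Q g).mulVec t.ofLp := by
  have hint : ∀ i j, Integrable (fun x => t i * t j * (g x i * g x j)) Q := fun i j =>
    ((hg i).integrable_mul (hg j)).const_mul _
  have hsq : ∀ x, inner ℝ (g x) t ^ 2 = ∑ i, ∑ j, t i * t j * (g x i * g x j) := fun x => by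
    rw [sq, PiLp.inner_apply, Finset.sum_mul_sum]
    refine Finset.sum_congr rfl fun i _ => Finset.sum_congr rfl fun j _ => ?_
    simp only [RCLike.inner_apply, conj_trivial]; ring
  simp_rw [hsq]
  rw [integral_finsetSum _ fun i _ => integrable_finsetSum _ fun j _ => hint i j]
  simp only [dotProduct, Matrix.mulVec, Finset.mul_sum]
  refine Finset.sum_congr rfl fun i _ => ?_
  rw [integral_finsetSum _ fun j _ => hint i j]
  refine Finset.sum_congr rfl fun j _ => ?_
  rw [integral_const_mul]
  simp only [secondMoment, Matrix.of_apply]; ring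

lemma memLp_inner {𝒳 ι : Type*} [MeasurableSpace 𝒳] [Fintype ι] {Q : Measure 𝒳}
    {g : 𝒳 → EuclideanSpace ℝ ι} (hg : ∀ i, MemLp (fun x => g x i) 2 Q)
    (t : EuclideanSpace ℝ ι) : MemLp (fun x => inner ℝ (g x) t) 2 Q := by
  simp only [PiLp.inner_apply, RCLike.inner_apply, conj_trivial]
  exact memLp_finsetSum _ fun i _ => (hg i).const_mul (t i)

lemma integral_inner_eq_zero {𝒳 ι : Type*} [MeasurableSpace 𝒳] [Fintype ι] {Q : Measure 𝒳}
    [IsFiniteMeasure Q] {g : 𝒳 → EuclideanSpace ℝ ι} (hg : ∀ i, MemLp (fun x => g x i) 2 Q)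
    (h0 : ∀ i, ∫ x, g x i ∂Q = 0) (t : EuclideanSpace ℝ ι) :
    ∫ x, inner ℝ (g x) t ∂Q = 0 := by
  simp only [PiLp.inner_apply, RCLike.inner_apply, conj_trivial]
  rw [integral_finsetSum _ fun i _ => ((hg i).integrable (by norm_num)).const_mul (t i)]
  simp [integral_const_mul, h0]

lemma dotProduct_fromBlocks_mulVec (A : Matrix (Fin d₁) (Fin d₁) ℝ) (B : Matrix (Fin d₂) (Fin d₂) ℝ)
    (t : EuclideanSpace ℝ (Fin d₁ ⊕ Fin d₂)) :
    t.ofLp ⬝ᵥ (Matrix.fromBlocks A 0 0 B).mulVec t.ofLp =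
      (fstParam t).ofLp ⬝ᵥ A.mulVec (fstParam t).ofLp +
        (sndParam t).ofLp ⬝ᵥ B.mulVec (sndParam t).ofLp := by
  simp [dotProduct, Matrix.mulVec, fstParam, sndParam]

lemma continuous_joinParam : Continuous fun p : EuclideanSpace ℝ (Fin d₁) ×
    EuclideanSpace ℝ (Fin d₂) => joinParam p.1 p.2 := by
  refine (PiLp.continuous_toLp 2 _).comp (continuous_pi fun i => ?_)
  cases i <;> simp <;> fun_prop

lemma measurable_joinParam : Measurable fun p : EuclideanSpace ℝ (Fin d₁) ×
    EuclideanSpace ℝ (Fin d₂) => joinParam p.1 p.2 :=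
  continuous_joinParam.measurable

/-- The central limit theorem for a pair of sample means over two independent samples. -/
lemma tendstoInDistribution_joinParam_average (hX₁ : IsIIDSample P Q₁ X₁)
    (hX₂ : IsIIDSample P Q₂ X₂)
    (hind : IndepFun (fun ω j => X₁ j ω) (fun ω j => X₂ j ω) P)
    {g₁ : 𝒳₁ → EuclideanSpace ℝ (Fin d₁)} {g₂ : 𝒳₂ → EuclideanSpace ℝ (Fin d₂)}
    (hm₁ : Measurable g₁) (hm₂ : Measurable g₂)
    (hL₁ : ∀ i, MemLp (fun x => g₁ x i) 2 Q₁) (hL₂ : ∀ i, MemLp (fun x => g₂ x i) 2 Q₂)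
    (h0₁ : ∀ i, ∫ x, g₁ x i ∂Q₁ = 0) (h0₂ : ∀ i, ∫ x, g₂ x i ∂Q₂ = 0)
    {n₁ n₂ : ℕ → ℕ} (hn₁ : Tendsto n₁ atTop atTop) (hn₂ : Tendsto n₂ atTop atTop)
    {α : ℝ} (hα : 0 < α) (hratio : Tendsto (fun k => (n₁ k : ℝ) / (n₂ k : ℝ)) atTop (𝓝 α))
    (hV : (Matrix.fromBlocks (α⁻¹ • secondMoment Q₁ g₁) 0 0 (secondMoment Q₂ g₂)).PosSemidef) :
    TendstoInDistribution (fun k ω => √(n₂ k : ℝ) • joinParam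
        ((n₁ k : ℝ)⁻¹ • ∑ j ∈ Finset.range (n₁ k), g₁ (X₁ j ω))
        ((n₂ k : ℝ)⁻¹ • ∑ j ∈ Finset.range (n₂ k), g₂ (X₂ j ω))) atTop
      (id : EuclideanSpace ℝ (Fin d₁ ⊕ Fin d₂) → EuclideanSpace ℝ (Fin d₁ ⊕ Fin d₂))
      (fun _ => P) (multivariateGaussian 0
        (Matrix.fromBlocks (α⁻¹ • secondMoment Q₁ g₁) 0 0 (secondMoment Q₂ g₂))) := by
  have hgX₁ : ∀ j, Measurable fun ω => g₁ (X₁ j ω) := fun j => hm₁.comp (hX₁.measurable j)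
  have hgX₂ : ∀ j, Measurable fun ω => g₂ (X₂ j ω) := fun j => hm₂.comp (hX₂.measurable j)
  have hS : ∀ k, Measurable fun ω => √(n₂ k : ℝ) • joinParam
        ((n₁ k : ℝ)⁻¹ • ∑ j ∈ Finset.range (n₁ k), g₁ (X₁ j ω))
        ((n₂ k : ℝ)⁻¹ • ∑ j ∈ Finset.range (n₂ k), g₂ (X₂ j ω)) := fun k => by
    refine Measurable.fun_const_smul (M := ℝ)
      (measurable_joinParam.comp (Measurable.prodMk ?_ ?_)) _
    · exact (Finset.measurable_fun_sum _ fun j _ => hgX₁ j).fun_const_smul (M := ℝ) _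
    · exact (Finset.measurable_fun_sum _ fun j _ => hgX₂ j).fun_const_smul (M := ℝ) _
  refine ⟨fun k => (hS k).aemeasurable, aemeasurable_id, ?_⟩
  refine ProbabilityMeasure.tendsto_iff_tendsto_charFun.2 fun t => ?_
  simp only [ProbabilityMeasure.coe_mk, Measure.map_id]
  rw [charFun_multivariateGaussian hV, dotProduct_fromBlocks_mulVec]
  set h₁ : 𝒳₁ → ℝ := fun x => inner ℝ (g₁ x) (fstParam t) with hh₁
  set h₂ : 𝒳₂ → ℝ := fun x => inner ℝ (g₂ x) (sndParam t) with hh₂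
  have hh₁m : Measurable h₁ := hm₁.inner_const
  have hh₂m : Measurable h₂ := hm₂.inner_const
  have := hX₁.isProbabilityMeasure
  have := hX₂.isProbabilityMeasure
  -- The first average has its own sample size: `√n₂ * n₁⁻¹ = c k * (√n₁)⁻¹`, and `c k = √(n₂ / n₁)`
  -- tends to `α^(-1/2)`, whose square is the factor `α⁻¹` in the covariance.
  set c : ℕ → ℝ := fun k => √(n₂ k : ℝ) * (√(n₁ k : ℝ))⁻¹ with hc
  have hclim : Tendsto c atTop (𝓝 (√α⁻¹)) := by
    refine ((hratio.inv₀ hα.ne').sqrt).congr fun k => ?_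
    rw [inv_div, Real.sqrt_div (Nat.cast_nonneg _), div_eq_mul_inv]
  have hlim₁ := hX₁.tendsto_charFun_scaled_sum hh₁m (memLp_inner hL₁ _)
    (integral_inner_eq_zero hL₁ h0₁ _) hn₁ hclim
  have hlim₂ := hX₂.tendsto_charFun_scaled_sum hh₂m (memLp_inner hL₂ _)
    (integral_inner_eq_zero hL₂ h0₂ _) hn₂ (tendsto_const_nhds (x := (1 : ℝ)))
  have hprod := hlim₁.mul hlim₂
  rw [integral_inner_sq hL₁, integral_inner_sq hL₂, ← Complex.exp_add,
    Real.sq_sqrt (by positivity)] at hprod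
  convert! hprod using 1
  · ext k
    set U : (ℕ → 𝒳₁) → ℝ := fun x =>
      c k * ((√(n₁ k : ℝ))⁻¹ * ∑ j ∈ Finset.range (n₁ k), h₁ (x j)) with hU
    set V : (ℕ → 𝒳₂) → ℝ := fun x =>
      1 * ((√(n₂ k : ℝ))⁻¹ * ∑ j ∈ Finset.range (n₂ k), h₂ (x j)) with hVdef
    have hUm : Measurable U := by
      refine ((Finset.measurable_fun_sum _ fun j _ => ?_).const_mul _).const_mul _
      exact hh₁m.comp (measurable_pi_apply j)
    have hVm : Measurable V := by
      refine ((Finset.measurable_fun_sum _ fun j _ => ?_).const_mul _).const_mul _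
      exact hh₂m.comp (measurable_pi_apply j)
    have hXm₁ : Measurable fun ω j => X₁ j ω := measurable_pi_lambda _ hX₁.measurable
    have hXm₂ : Measurable fun ω j => X₂ j ω := measurable_pi_lambda _ hX₂.measurable
    -- The inner product with `t` splits into a functional `U` of the first sample and a functional
    -- `V` of the second; by independence the characteristic function factors.
    have hmul := (hind.comp hUm hVm).charFun_map_fun_add_eq_mul
      (hUm.comp hXm₁).aemeasurable (hVm.comp hXm₂).aemeasurable
    refine Eq.trans ?_ (congrFun hmul 1)
    rw [charFun_apply, charFun_apply, integral_map (hS k).aemeasurable (by fun_prop),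
      integral_map ((hUm.comp hXm₁).fun_add (hVm.comp hXm₂)).aemeasurable (by fun_prop)]
    refine integral_congr_ae (ae_of_all _ fun ω => ?_)
    have hkey : inner ℝ (√(n₂ k : ℝ) • joinParam
        ((n₁ k : ℝ)⁻¹ • ∑ j ∈ Finset.range (n₁ k), g₁ (X₁ j ω))
        ((n₂ k : ℝ)⁻¹ • ∑ j ∈ Finset.range (n₂ k), g₂ (X₂ j ω))) t =
        U (fun j => X₁ j ω) + V (fun j => X₂ j ω) := by
      -- Both identities also hold at sample size `0`, where all the inverses are `0`.
      have hs : ∀ n : ℕ, (n : ℝ)⁻¹ = (√(n : ℝ))⁻¹ * (√(n : ℝ))⁻¹ := fun n => by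
        rw [← mul_inv, Real.mul_self_sqrt (Nat.cast_nonneg n)]
      have hs' : √(n₂ k : ℝ) * (n₂ k : ℝ)⁻¹ = (√(n₂ k : ℝ))⁻¹ := by
        rw [← div_eq_mul_inv, Real.sqrt_div_self', one_div]
      rw [real_inner_smul_left, inner_joinParam, real_inner_smul_left, real_inner_smul_left,
        sum_inner, sum_inner, mul_add, ← mul_assoc _ (n₂ k : ℝ)⁻¹, hs', hs (n₁ k)]
      simp only [hU, hVdef, hc, hh₁, hh₂]
      ring
    simp [hkey]
  · congr 2
    simp [Matrix.smul_mulVec, dotProduct_smul]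
    ring

/-- The log likelihoods are smooth only almost surely, so the scores are merely almost everywhere
measurable. Passing to measurable representatives changes neither the moments nor, almost surely,
the averages. -/
lemma tendstoInDistribution_joinParam_average_of_aemeasurable (hX₁ : IsIIDSample P Q₁ X₁)
    (hX₂ : IsIIDSample P Q₂ X₂)
    (hind : IndepFun (fun ω j => X₁ j ω) (fun ω j => X₂ j ω) P)
    {g₁ : 𝒳₁ → EuclideanSpace ℝ (Fin d₁)} {g₂ : 𝒳₂ → EuclideanSpace ℝ (Fin d₂)}
    (hm₁ : AEMeasurable g₁ Q₁) (hm₂ : AEMeasurable g₂ Q₂)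
    (hL₁ : ∀ i, MemLp (fun x => g₁ x i) 2 Q₁) (hL₂ : ∀ i, MemLp (fun x => g₂ x i) 2 Q₂)
    (h0₁ : ∀ i, ∫ x, g₁ x i ∂Q₁ = 0) (h0₂ : ∀ i, ∫ x, g₂ x i ∂Q₂ = 0)
    {n₁ n₂ : ℕ → ℕ} (hn₁ : Tendsto n₁ atTop atTop) (hn₂ : Tendsto n₂ atTop atTop)
    {α : ℝ} (hα : 0 < α) (hratio : Tendsto (fun k => (n₁ k : ℝ) / (n₂ k : ℝ)) atTop (𝓝 α))
    (hV : (Matrix.fromBlocks (α⁻¹ • secondMoment Q₁ g₁) 0 0 (secondMoment Q₂ g₂)).PosSemidef) :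
    TendstoInDistribution (fun k ω => √(n₂ k : ℝ) • joinParam
        ((n₁ k : ℝ)⁻¹ • ∑ j ∈ Finset.range (n₁ k), g₁ (X₁ j ω))
        ((n₂ k : ℝ)⁻¹ • ∑ j ∈ Finset.range (n₂ k), g₂ (X₂ j ω))) atTop
      (id : EuclideanSpace ℝ (Fin d₁ ⊕ Fin d₂) → EuclideanSpace ℝ (Fin d₁ ⊕ Fin d₂))
      (fun _ => P) (multivariateGaussian 0
        (Matrix.fromBlocks (α⁻¹ • secondMoment Q₁ g₁) 0 0 (secondMoment Q₂ g₂))) := by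
  have e₁ := hm₁.ae_eq_mk
  have e₂ := hm₂.ae_eq_mk
  have c₁ : ∀ i, (fun x => g₁ x i) =ᵐ[Q₁] fun x => hm₁.mk g₁ x i := fun i => by
    filter_upwards [e₁] with x hx using by rw [hx]
  have c₂ : ∀ i, (fun x => g₂ x i) =ᵐ[Q₂] fun x => hm₂.mk g₂ x i := fun i => by
    filter_upwards [e₂] with x hx using by rw [hx]
  have s₁ : secondMoment Q₁ g₁ = secondMoment Q₁ (hm₁.mk g₁) :=
    Matrix.ext fun i j => integral_congr_ae ((c₁ i).mul (c₁ j))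
  have s₂ : secondMoment Q₂ g₂ = secondMoment Q₂ (hm₂.mk g₂) :=
    Matrix.ext fun i j => integral_congr_ae ((c₂ i).mul (c₂ j))
  rw [s₁, s₂] at hV ⊢
  refine (tendstoInDistribution_joinParam_average hX₁ hX₂ hind hm₁.measurable_mk hm₂.measurable_mk
    (fun i => (hL₁ i).ae_eq (c₁ i)) (fun i => (hL₂ i).ae_eq (c₂ i))
    (fun i => by rw [← integral_congr_ae (c₁ i), h0₁])
    (fun i => by rw [← integral_congr_ae (c₂ i), h0₂]) hn₁ hn₂ hα hratio hV).congr
    (fun k => ?_) Filter.EventuallyEq.rfl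
  filter_upwards [hX₁.ae_forall e₁, hX₂.ae_forall e₂] with ω h₁ h₂
  simp [h₁, h₂]

/-- Characteristic functions agree once `M` is moved to the other side of the inner product as its
transpose. -/
lemma map_toEuclideanCLM_multivariateGaussian {ι : Type*} [Fintype ι] [DecidableEq ι]
    {V : Matrix ι ι ℝ} (hV : V.PosSemidef) (M : Matrix ι ι ℝ) :
    (multivariateGaussian 0 V).map (Matrix.toEuclideanCLM (𝕜 := ℝ) M) =
      multivariateGaussian 0 (M * V * M.transpose) := by
  have hMV : (M * V * M.transpose).PosSemidef := by
    simpa [Matrix.conjTranspose_eq_transpose_of_trivial] using hV.mul_mul_conjTranspose_same M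
  refine Measure.ext_of_charFun (funext fun t => ?_)
  have hadj : ∀ x, inner ℝ (Matrix.toEuclideanCLM (𝕜 := ℝ) M x) t =
      inner ℝ x (Matrix.toEuclideanCLM (𝕜 := ℝ) M.transpose t) := fun x => by
    rw [← ContinuousLinearMap.adjoint_inner_right, ← ContinuousLinearMap.star_eq_adjoint,
      ← map_star, Matrix.star_eq_conjTranspose, Matrix.conjTranspose_eq_transpose_of_trivial]
  rw [charFun_apply, integral_map (by fun_prop) (by fun_prop)]
  simp_rw [hadj]
  rw [← charFun_apply, charFun_multivariateGaussian hV, charFun_multivariateGaussian hMV]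
  have hq : (Matrix.toEuclideanCLM (𝕜 := ℝ) M.transpose t).ofLp ⬝ᵥ
      V.mulVec (Matrix.toEuclideanCLM (𝕜 := ℝ) M.transpose t).ofLp =
      t.ofLp ⬝ᵥ (M * V * M.transpose).mulVec t.ofLp := by
    rw [Matrix.ofLp_toEuclideanCLM, ← Matrix.mulVec_mulVec, ← Matrix.mulVec_mulVec,
      Matrix.dotProduct_mulVec _ M, Matrix.mulVec_transpose]
  rw [hq, inner_zero_right, inner_zero_right]

end CLT

/-! ### Joint parameters -/

section JoinParam

variable {d₁ d₂ : ℕ}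

@[simp] lemma fstParam_joinParam (a : EuclideanSpace ℝ (Fin d₁)) (b : EuclideanSpace ℝ (Fin d₂)) :
    fstParam (joinParam a b) = a := rfl

@[simp] lemma sndParam_joinParam (a : EuclideanSpace ℝ (Fin d₁)) (b : EuclideanSpace ℝ (Fin d₂)) :
    sndParam (joinParam a b) = b := rfl

lemma joinParam_sub (a a' : EuclideanSpace ℝ (Fin d₁)) (b b' : EuclideanSpace ℝ (Fin d₂)) :
    joinParam a b - joinParam a' b' = joinParam (a - a') (b - b') := by
  ext i; cases i <;> simp [joinParam]

lemma joinParam_add_single_inr (a : EuclideanSpace ℝ (Fin d₁)) (b : EuclideanSpace ℝ (Fin d₂))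
    (i : Fin d₂) (s : ℝ) :
    joinParam a b + s • EuclideanSpace.single (Sum.inr i) (1 : ℝ) =
      joinParam a (b + s • EuclideanSpace.single i (1 : ℝ)) := by
  ext j; cases j <;> simp [joinParam]

lemma continuous_fstParam :
    Continuous (fstParam : EuclideanSpace ℝ (Fin d₁ ⊕ Fin d₂) → EuclideanSpace ℝ (Fin d₁)) :=
  (PiLp.continuous_toLp 2 _).comp (by fun_prop)

lemma continuous_sndParam :
    Continuous (sndParam : EuclideanSpace ℝ (Fin d₁ ⊕ Fin d₂) → EuclideanSpace ℝ (Fin d₂)) :=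
  (PiLp.continuous_toLp 2 _).comp (by fun_prop)

/-- `B₁ × B₂` is not a Euclidean ball of the joint space, whereas `SmoothLogLik` is stated on balls.
-/
lemma exists_ball_subset_nbhd (θ₁s : EuclideanSpace ℝ (Fin d₁)) (θ₂s : EuclideanSpace ℝ (Fin d₂))
    {r₁ r₂ : ℝ} (hr₁ : 0 < r₁) (hr₂ : 0 < r₂) :
    ∃ r > 0, Metric.ball (joinParam θ₁s θ₂s) r ⊆ CutModel.nbhd θ₁s θ₂s r₁ r₂ := by
  have ho : IsOpen (CutModel.nbhd θ₁s θ₂s r₁ r₂) :=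
    (Metric.isOpen_ball.preimage continuous_fstParam).inter
      (Metric.isOpen_ball.preimage continuous_sndParam)
  refine Metric.isOpen_iff.1 ho _ ⟨?_, ?_⟩ <;> simpa

end JoinParam

/-! ### Coordinatewise errors, maxima along lines, moment bounds -/

lemma isLittleO_euclidean {κ F ι : Type*} [NormedAddCommGroup F] [Fintype ι] {l : Filter κ}
    {w : κ → EuclideanSpace ℝ ι} {u : κ → F} (h : ∀ i, (fun p => w p i) =o[l] u) : w =o[l] u := by
  have hs : (fun p => ∑ i, ‖w p i‖) =o[l] u := by
    simpa [Finset.sum_fn] using Asymptotics.IsLittleO.sum fun i (_ : i ∈ Finset.univ) =>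
      (h i).norm_left
  refine Asymptotics.IsBigO.trans_isLittleO (Asymptotics.IsBigO.of_bound 1 ?_) hs
  refine Eventually.of_forall fun p => ?_
  rw [one_mul, Real.norm_of_nonneg (Finset.sum_nonneg fun _ _ => norm_nonneg _),
    EuclideanSpace.norm_eq]
  refine Real.sqrt_le_iff.2 ⟨Finset.sum_nonneg fun _ _ => norm_nonneg _, ?_⟩
  exact Finset.sum_sq_le_sq_sum_of_nonneg fun _ _ => norm_nonneg _

lemma IsUniqueMaximizer.isLocalMax_line {ι : Type*} [Fintype ι] [DecidableEq ι]
    {g : EuclideanSpace ℝ ι → ℝ} {S : Set (EuclideanSpace ℝ ι)} {t : EuclideanSpace ℝ ι}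
    (h : IsUniqueMaximizer g S t) (hS : S ∈ 𝓝 t) (i : ι) :
    IsLocalMax (fun s : ℝ => g (t + s • EuclideanSpace.single i (1 : ℝ))) 0 := by
  filter_upwards [tendsto_line t i hS] with s hs
  by_cases hst : t + s • EuclideanSpace.single i (1 : ℝ) = t
  · simp [hst]
  · simpa using (h.2 _ hs hst).le

lemma memLp_two_abs_of_integrable_pow_four {𝒳 : Type*} [MeasurableSpace 𝒳] {Q : Measure 𝒳}
    [IsFiniteMeasure Q] {G : 𝒳 → ℝ} (hm : Measurable G) (h : Integrable (fun x => G x ^ 4) Q) :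
    MemLp (fun x => |G x|) 2 Q := by
  rw [memLp_two_iff_integrable_sq hm.abs.aestronglyMeasurable]
  refine (h.add (integrable_const 1)).mono (hm.abs.pow_const 2).aestronglyMeasurable
    (ae_of_all _ fun x => ?_)
  rw [sq_abs, Real.norm_of_nonneg (sq_nonneg _), Pi.add_apply,
    Real.norm_of_nonneg (by positivity)]
  -- `(G² - 1)² ≥ 0` gives `2 G² ≤ G⁴ + 1`.
  nlinarith [sq_nonneg (G x ^ 2 - 1)]

namespace CutModel

variable {𝒳₁ 𝒳₂ : Type*} [MeasurableSpace 𝒳₁] [MeasurableSpace 𝒳₂] {d₁ d₂ : ℕ}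
  {m : CutModel 𝒳₁ 𝒳₂ d₁ d₂}

/-! ### Log likelihoods -/

lemma log_coe_eq_coe_log {c : ℝ≥0} (hc : 0 < c) :
    ENNReal.log (c : ℝ≥0∞) = ((Real.log c : ℝ) : EReal) := by
  rw [ENNReal.log_pos_real' (by simpa using hc)]; simp

lemma coe_sum_ereal {β : Type*} (s : Finset β) (f : β → ℝ) :
    ((∑ b ∈ s, f b : ℝ) : EReal) = ∑ b ∈ s, (f b : EReal) := by
  classical
  induction s using Finset.induction_on with
  | empty => simp
  | insert a s ha ih => rw [Finset.sum_insert ha, Finset.sum_insert ha, EReal.coe_add, ih]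

lemma logLik₁_eq_coe {n : ℕ} {x : ℕ → 𝒳₁} {θ₁ : EuclideanSpace ℝ (Fin d₁)}
    (h : ∀ j, 0 < m.f₁ θ₁ (x j)) :
    m.logLik₁ n x θ₁ = ((∑ j ∈ Finset.range n, m.ell₁ (x j) θ₁ : ℝ) : EReal) := by
  rw [coe_sum_ereal]
  exact Finset.sum_congr rfl fun j _ => log_coe_eq_coe_log (h j)

lemma logLik₂_eq_coe {n : ℕ} {x : ℕ → 𝒳₂} {θ₁ : EuclideanSpace ℝ (Fin d₁)}
    {θ₂ : EuclideanSpace ℝ (Fin d₂)} (h : ∀ j, 0 < m.f₂ θ₁ θ₂ (x j)) :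
    m.logLik₂ n x θ₁ θ₂ =
      ((∑ j ∈ Finset.range n, m.ell₂ (x j) (joinParam θ₁ θ₂) : ℝ) : EReal) := by
  rw [coe_sum_ereal]
  exact Finset.sum_congr rfl fun j _ => log_coe_eq_coe_log (h j)

variable {Q₁ : Measure 𝒳₁} {Q₂ : Measure 𝒳₂} {θ₁s : EuclideanSpace ℝ (Fin d₁)}
  {θ₂s : EuclideanSpace ℝ (Fin d₂)} {r₁ r₂ : ℝ}

lemma SmoothnessCondition.smoothLogLik₁ [IsFiniteMeasure Q₁]
    (h : m.SmoothnessCondition Q₁ Q₂ θ₁s θ₂s r₁ r₂) (hr₁ : 0 < r₁) :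
    ∃ G₁ G₂ G₃, SmoothLogLik Q₁ m.ell₁ θ₁s r₁ G₁ G₂ G₃ := by
  obtain ⟨G₁, G₂, G₃, hm₁, hm₂, hm₃, hi₁, hi₂, hi₃, hb⟩ := h.moments₁
  refine ⟨fun x => |G₁ x|, fun x => |G₂ x|, fun x => |G₃ x|, hr₁, fun θ hθ => ?_,
    h.smooth₁.mono fun x hx => hx.2, fun x => ⟨abs_nonneg _, abs_nonneg _, abs_nonneg _⟩,
    memLp_two_abs_of_integrable_pow_four hm₁ hi₁,
    (memLp_two_abs_of_integrable_pow_four hm₂ hi₂).integrable (by norm_num), hi₃.abs, ?_⟩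
  · exact (Real.measurable_log.comp
      (measurable_coe_nnreal_real.comp (m.measurable_f₁ θ (h.ball_subset₁ hθ)))).aemeasurable
  · filter_upwards [hb] with x hx θ hθ i j k
    obtain ⟨a, b, c⟩ := hx θ hθ i j k
    exact ⟨a.trans (le_abs_self _), b.trans (le_abs_self _), c.trans (le_abs_self _)⟩

lemma SmoothnessCondition.smoothLogLik₂ [IsFiniteMeasure Q₂]
    (h : m.SmoothnessCondition Q₁ Q₂ θ₁s θ₂s r₁ r₂) {r : ℝ} (hr : 0 < r)
    (hsub : Metric.ball (joinParam θ₁s θ₂s) r ⊆ nbhd θ₁s θ₂s r₁ r₂) :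
    ∃ G₁ G₂ G₃, SmoothLogLik Q₂ m.ell₂ (joinParam θ₁s θ₂s) r G₁ G₂ G₃ := by
  obtain ⟨G₁, G₂, G₃, hm₁, hm₂, hm₃, hi₁, hi₂, hi₃, hb⟩ := h.moments₂
  refine ⟨fun x => |G₁ x|, fun x => |G₂ x|, fun x => |G₃ x|, hr, fun θ hθ => ?_,
    h.smooth₂.mono fun x hx => hx.2.mono hsub,
    fun x => ⟨abs_nonneg _, abs_nonneg _, abs_nonneg _⟩,
    memLp_two_abs_of_integrable_pow_four hm₁ hi₁,
    (memLp_two_abs_of_integrable_pow_four hm₂ hi₂).integrable (by norm_num), hi₃.abs, ?_⟩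
  · exact (Real.measurable_log.comp (measurable_coe_nnreal_real.comp (m.measurable_f₂ _
      (h.ball_subset₁ (hsub hθ).1) _ (h.ball_subset₂ (hsub hθ).2)))).aemeasurable
  · filter_upwards [hb] with x hx θ hθ i j k
    obtain ⟨a, b, c⟩ := hx θ (hsub hθ) i j k
    exact ⟨a.trans (le_abs_self _), b.trans (le_abs_self _), c.trans (le_abs_self _)⟩

/-! ### Consistency and estimating equations -/

variable {Ω : Type*} [MeasurableSpace Ω] {P : Measure Ω}
  {X₁ : ℕ → Ω → 𝒳₁} {X₂ : ℕ → Ω → 𝒳₂} {n₁ n₂ : ℕ → ℕ}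
  {θ₁hat : ℕ → Ω → EuclideanSpace ℝ (Fin d₁)} {θ₂hat : ℕ → Ω → EuclideanSpace ℝ (Fin d₂)}

/-- An estimator at distance at least `δ` would give `L(θ₁s) ≤ L(θ₁hat) ≤ L(θ₁s) - n ε`. This is
absurd for `n ≥ 1` because `L(θ₁s)` is almost surely finite; at the value `-∞` it would be no
contradiction. -/
lemma tendsto_firstStage (hX₁ : IsIIDSample P Q₁ X₁) (hlog : m.LogLikCondition Q₁ Q₂)
    (hident : m.IdentifiabilityCondition Q₁ Q₂ P X₁ X₂ θ₁s θ₂s)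
    (hn₁ : Tendsto n₁ atTop atTop)
    (hmle₁ : ∀ᶠ p : ℕ × Ω in whp P,
      m.IsFirstStageMLE (n₁ p.1) (fun j => X₁ j p.2) (θ₁hat p.1 p.2)) :
    Tendsto (fun p : ℕ × Ω => θ₁hat p.1 p.2) (whp P) (𝓝 θ₁s) := by
  rw [Metric.tendsto_nhds]
  intro δ hδ
  obtain ⟨ε, hε, hsep⟩ := hident.separated₁ δ hδ
  have hsep' := eventually_whp (q := fun p : ℕ × Ω => ∀ θ₁ ∈ m.Θ₁, δ ≤ ‖θ₁ - θ₁s‖ →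
    m.logLik₁ (n₁ p.1) (fun j => X₁ j p.2) θ₁ ≤
      m.logLik₁ (n₁ p.1) (fun j => X₁ j p.2) θ₁s - ((n₁ p.1 * ε : ℝ) : EReal)).2
    (hsep.comp hn₁)
  filter_upwards [hmle₁, hsep', tendsto_fst_whp.eventually (hn₁.eventually_ge_atTop 1),
    hX₁.eventually_whp (hlog.pos₁ θ₁s hident.unique₁.1)] with p hp hs hn hpos
  by_contra hd
  rw [not_lt, dist_eq_norm] at hd
  have h := (hp.2 θ₁s hident.unique₁.1).trans (hs _ hp.1 hd)
  rw [logLik₁_eq_coe hpos, ← EReal.coe_sub, EReal.coe_le_coe_iff] at h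
  have : (1 : ℝ) ≤ n₁ p.1 := by exact_mod_cast hn
  nlinarith

/-- By consistency the maximizer lies in the open ball `B₁ ⊆ Θ₁`. There the likelihood is positive,
so the extended-real criterion is a differentiable real function with an interior maximum. -/
lemma eventually_firstStage_score_eq_zero {G₁ G₂ G₃ : 𝒳₁ → ℝ} (hX₁ : IsIIDSample P Q₁ X₁)
    (hsmooth : m.SmoothnessCondition Q₁ Q₂ θ₁s θ₂s r₁ r₂)
    (hS : SmoothLogLik Q₁ m.ell₁ θ₁s r₁ G₁ G₂ G₃)
    (hmle₁ : ∀ᶠ p : ℕ × Ω in whp P,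
      m.IsFirstStageMLE (n₁ p.1) (fun j => X₁ j p.2) (θ₁hat p.1 p.2))
    (hcons : Tendsto (fun p : ℕ × Ω => θ₁hat p.1 p.2) (whp P) (𝓝 θ₁s)) (i : Fin d₁) :
    ∀ᶠ p : ℕ × Ω in whp P,
      ∑ j ∈ Finset.range (n₁ p.1), pderiv i (m.ell₁ (X₁ j p.2)) (θ₁hat p.1 p.2) = 0 := by
  filter_upwards [hmle₁, hcons.eventually (Metric.isOpen_ball.mem_nhds hS.mem_ball),
    hX₁.eventually_whp hsmooth.smooth₁, hX₁.eventually_whp hS.differentiableAt]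
    with p hp hball hpos hdiff
  rw [← pderiv_sum _ _ fun j _ => hdiff j _ hball]
  refine pderiv_eq_zero_of_isLocalMax_line i
    (DifferentiableAt.fun_sum fun j _ => hdiff j _ hball) ?_
  filter_upwards [tendsto_line _ i (Metric.isOpen_ball.mem_nhds hball)] with s hs
  have h := hp.2 _ (hsmooth.ball_subset₁ hs)
  rw [logLik₁_eq_coe fun j => (hpos j).1 _ hs, logLik₁_eq_coe fun j => (hpos j).1 _ hball,
    EReal.coe_le_coe_iff] at h
  simpa using h

/-- Maximality compares `θ₂hat` with `θ₂s` at `θ₁hat`, while separation compares with `(θ₁s, θ₂s)`.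
The gap between the two reference values, per observation, is at most a convergent average of `G₁`
times `‖θ₁hat - θ₁s‖`, hence eventually below `ε`. -/
lemma tendsto_secondStage [IsProbabilityMeasure P] {G₁ G₂ G₃ : 𝒳₂ → ℝ} {r : ℝ} (hX₂ : IsIIDSample P Q₂ X₂)
    (hident : m.IdentifiabilityCondition Q₁ Q₂ P X₁ X₂ θ₁s θ₂s)
    (hsmooth : m.SmoothnessCondition Q₁ Q₂ θ₁s θ₂s r₁ r₂)
    (hsub : Metric.ball (joinParam θ₁s θ₂s) r ⊆ nbhd θ₁s θ₂s r₁ r₂)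
    (hS : SmoothLogLik Q₂ m.ell₂ (joinParam θ₁s θ₂s) r G₁ G₂ G₃)
    (hn₂ : Tendsto n₂ atTop atTop)
    (hcons : Tendsto (fun p : ℕ × Ω => θ₁hat p.1 p.2) (whp P) (𝓝 θ₁s))
    (hmle₂ : ∀ᶠ p : ℕ × Ω in whp P,
      m.IsSecondStageMLE (n₂ p.1) (fun j => X₂ j p.2) (θ₁hat p.1 p.2) (θ₂hat p.1 p.2)) :
    Tendsto (fun p : ℕ × Ω => θ₂hat p.1 p.2) (whp P) (𝓝 θ₂s) := by
  have := hX₂.isProbabilityMeasure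
  rw [Metric.tendsto_nhds]
  intro δ hδ
  obtain ⟨ε, hε, η, hη, hsep⟩ := hident.separated₂ δ hδ
  have hsep' := eventually_whp (q := fun p : ℕ × Ω => ∀ θ₁ ∈ m.Θ₁, ∀ θ₂ ∈ m.Θ₂,
    ‖θ₁ - θ₁s‖ < η → δ ≤ ‖θ₂ - θ₂s‖ →
    m.logLik₂ (n₂ p.1) (fun j => X₂ j p.2) θ₁ θ₂ ≤
      m.logLik₂ (n₂ p.1) (fun j => X₂ j p.2) θ₁s θ₂s - ((n₂ p.1 * ε : ℝ) : EReal)).2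
    (hsep.comp hn₂)
  have hjoin : Tendsto (fun p : ℕ × Ω => joinParam (θ₁hat p.1 p.2) θ₂s) (whp P)
      (𝓝 (joinParam θ₁s θ₂s)) :=
    (continuous_joinParam.tendsto (θ₁s, θ₂s)).comp (hcons.prodMk_nhds tendsto_const_nhds)
  have hsmall : Tendsto (fun p : ℕ × Ω => (Fintype.card (Fin d₁ ⊕ Fin d₂) : ℝ) *
      ((n₂ p.1 : ℝ)⁻¹ * ∑ j ∈ Finset.range (n₂ p.1), G₁ (X₂ j p.2)) *
      ‖joinParam (θ₁hat p.1 p.2) θ₂s - joinParam θ₁s θ₂s‖) (whp P) (𝓝 0) := by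
    simpa using ((hX₂.tendsto_average (hS.memLp.integrable (by norm_num)) hn₂).const_mul _).mul
      (tendsto_iff_norm_sub_tendsto_zero.1 hjoin)
  filter_upwards [hmle₂, hsep', tendsto_fst_whp.eventually (hn₂.eventually_ge_atTop 1),
    hX₂.eventually_whp hsmooth.smooth₂, hX₂.eventually_whp hS.abs_sub_le,
    hjoin.eventually (Metric.isOpen_ball.mem_nhds hS.mem_ball),
    hcons.eventually (Metric.ball_mem_nhds θ₁s hη), hsmall.eventually_lt_const hε]
    with p hp hs hn hpos hlip hball hη' hlt
  by_contra hd
  rw [not_lt, dist_eq_norm] at hd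
  have h1 : ‖θ₁hat p.1 p.2 - θ₁s‖ < η := by rwa [← dist_eq_norm]
  have hΘ₁ : θ₁hat p.1 p.2 ∈ m.Θ₁ := hsmooth.ball_subset₁ (hsub hball).1
  -- `L(θ₁hat, θ₂s) ≤ L(θ₁hat, θ₂hat) ≤ L(θ₁s, θ₂s) - n ε`, contradicting the Lipschitz bound
  -- `hdiff` below.
  have h := (hp.2 θ₂s hident.unique₂.1).trans (hs _ hΘ₁ _ hp.1 h1 hd)
  have hpos' : ∀ a b, joinParam a b ∈ Metric.ball (joinParam θ₁s θ₂s) r →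
      ∀ j, 0 < m.f₂ a b (X₂ j p.2) := fun _ _ hab j => (hpos j).1 _ (hsub hab)
  rw [logLik₂_eq_coe (hpos' _ _ hball), logLik₂_eq_coe (hpos' _ _ hS.mem_ball), ← EReal.coe_sub,
    EReal.coe_le_coe_iff] at h
  have hn' : (0 : ℝ) < n₂ p.1 := by exact_mod_cast hn
  have hdiff : |∑ j ∈ Finset.range (n₂ p.1), (m.ell₂ (X₂ j p.2) (joinParam (θ₁hat p.1 p.2) θ₂s) -
      m.ell₂ (X₂ j p.2) (joinParam θ₁s θ₂s))| ≤ ∑ j ∈ Finset.range (n₂ p.1),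
        (Fintype.card (Fin d₁ ⊕ Fin d₂) : ℝ) * G₁ (X₂ j p.2) *
          ‖joinParam (θ₁hat p.1 p.2) θ₂s - joinParam θ₁s θ₂s‖ :=
    (Finset.abs_sum_le_sum_abs _ _).trans
      (Finset.sum_le_sum fun j _ => hlip j _ hS.mem_ball _ hball)
  rw [← Finset.sum_mul, ← Finset.mul_sum, Finset.sum_sub_distrib] at hdiff
  have hlt' := mul_lt_mul_of_pos_left hlt hn'
  have hcancel : (n₂ p.1 : ℝ) * ((Fintype.card (Fin d₁ ⊕ Fin d₂) : ℝ) *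
      ((n₂ p.1 : ℝ)⁻¹ * ∑ j ∈ Finset.range (n₂ p.1), G₁ (X₂ j p.2)) *
      ‖joinParam (θ₁hat p.1 p.2) θ₂s - joinParam θ₁s θ₂s‖) =
      (Fintype.card (Fin d₁ ⊕ Fin d₂) : ℝ) * (∑ j ∈ Finset.range (n₂ p.1), G₁ (X₂ j p.2)) *
      ‖joinParam (θ₁hat p.1 p.2) θ₂s - joinParam θ₁s θ₂s‖ := by
    field_simp
  rw [hcancel] at hlt'
  have := (abs_le.1 hdiff).1
  linarith

lemma eventually_secondStage_score_eq_zero {G₁ G₂ G₃ : 𝒳₂ → ℝ} {r : ℝ}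
    (hX₂ : IsIIDSample P Q₂ X₂)
    (hsmooth : m.SmoothnessCondition Q₁ Q₂ θ₁s θ₂s r₁ r₂)
    (hsub : Metric.ball (joinParam θ₁s θ₂s) r ⊆ nbhd θ₁s θ₂s r₁ r₂)
    (hS : SmoothLogLik Q₂ m.ell₂ (joinParam θ₁s θ₂s) r G₁ G₂ G₃)
    (hmle₂ : ∀ᶠ p : ℕ × Ω in whp P,
      m.IsSecondStageMLE (n₂ p.1) (fun j => X₂ j p.2) (θ₁hat p.1 p.2) (θ₂hat p.1 p.2))
    (hcons : Tendsto (fun p : ℕ × Ω => joinParam (θ₁hat p.1 p.2) (θ₂hat p.1 p.2)) (whp P)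
      (𝓝 (joinParam θ₁s θ₂s))) (i : Fin d₂) :
    ∀ᶠ p : ℕ × Ω in whp P, ∑ j ∈ Finset.range (n₂ p.1), pderiv (Sum.inr i) (m.ell₂ (X₂ j p.2))
      (joinParam (θ₁hat p.1 p.2) (θ₂hat p.1 p.2)) = 0 := by
  filter_upwards [hmle₂, hcons.eventually (Metric.isOpen_ball.mem_nhds hS.mem_ball),
    hX₂.eventually_whp hsmooth.smooth₂, hX₂.eventually_whp hS.differentiableAt]
    with p hp hball hpos hdiff
  rw [← pderiv_sum _ _ fun j _ => hdiff j _ hball]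
  refine pderiv_eq_zero_of_isLocalMax_line (Sum.inr i)
    (DifferentiableAt.fun_sum fun j _ => hdiff j _ hball) ?_
  filter_upwards [tendsto_line _ (Sum.inr i) (Metric.isOpen_ball.mem_nhds hball)] with s hs
  rw [Set.mem_preimage, joinParam_add_single_inr] at hs
  have h := hp.2 _ (hsmooth.ball_subset₂ (hsub hs).2)
  simp only [sndParam_joinParam] at h
  have hpos' : ∀ a b, joinParam a b ∈ Metric.ball (joinParam θ₁s θ₂s) r →
      ∀ j, 0 < m.f₂ a b (X₂ j p.2) := fun _ _ hab j => (hpos j).1 _ (hsub hab)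
  rw [logLik₂_eq_coe (hpos' _ _ hs), logLik₂_eq_coe (hpos' _ _ hball), EReal.coe_le_coe_iff] at h
  simpa [joinParam_add_single_inr] using h

end CutModel

/-! ### The sandwich formula -/

section Sandwich

variable {p q : Type*}

lemma transpose_eq_of_posDef {J : Matrix p p ℝ} (h : J.PosDef) : J.transpose = J := by
  simpa [Matrix.conjTranspose_eq_transpose_of_trivial] using h.isHermitian.eq

variable [Fintype p] [Fintype q] [DecidableEq p]

/-- The off-diagonal blocks vanish, so the Schur complement of `A` is `B` itself. -/
lemma posSemidef_fromBlocks_diagonal {A : Matrix p p ℝ} {B : Matrix q q ℝ} (hA : A.PosDef)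
    (hB : B.PosDef) : (Matrix.fromBlocks A 0 0 B).PosSemidef := by
  have : Invertible A := hA.isUnit.invertible
  simpa using (Matrix.PosDef.fromBlocks₁₁ (0 : Matrix p q ℝ) B hA).2 (by simpa using hB.posSemidef)

variable [DecidableEq q]

/-- The inverse of the block triangular matrix `[[J₁, 0], [Rᵀ, J₂]]`. -/
noncomputable def triangularInv (J₁ : Matrix p p ℝ) (J₂ : Matrix q q ℝ) (R : Matrix p q ℝ) :
    Matrix (p ⊕ q) (p ⊕ q) ℝ :=
  Matrix.fromBlocks J₁⁻¹ 0 (-(J₂⁻¹ * R.transpose * J₁⁻¹)) J₂⁻¹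

lemma triangularInv_mul {J₁ : Matrix p p ℝ} {J₂ : Matrix q q ℝ} (R : Matrix p q ℝ)
    (h₁ : J₁.PosDef) (h₂ : J₂.PosDef) :
    triangularInv J₁ J₂ R * Matrix.fromBlocks J₁ 0 R.transpose J₂ = 1 := by
  have e₁ : J₁⁻¹ * J₁ = 1 := Matrix.nonsing_inv_mul _ ((Matrix.isUnit_iff_isUnit_det _).1 h₁.isUnit)
  have e₂ : J₂⁻¹ * J₂ = 1 := Matrix.nonsing_inv_mul _ ((Matrix.isUnit_iff_isUnit_det _).1 h₂.isUnit)
  rw [triangularInv, Matrix.fromBlocks_multiply]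
  simp [e₁, e₂, Matrix.mul_assoc]

/-- Block multiplication; positive definiteness makes `J₁` and `J₂` symmetric, so their inverses
survive transposition. -/
lemma triangularInv_sandwich {J₁ : Matrix p p ℝ} {J₂ : Matrix q q ℝ} (R : Matrix p q ℝ)
    (I₁ : Matrix p p ℝ) (I₂ : Matrix q q ℝ) (a : ℝ) (h₁ : J₁.PosDef) (h₂ : J₂.PosDef) :
    triangularInv J₁ J₂ R * Matrix.fromBlocks (a • I₁) 0 0 I₂ * (triangularInv J₁ J₂ R).transpose =
      Matrix.fromBlocks (a • (J₁⁻¹ * I₁ * J₁⁻¹)) (-(a • (J₁⁻¹ * I₁ * J₁⁻¹ * R * J₂⁻¹)))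
        (-(a • (J₂⁻¹ * R.transpose * (J₁⁻¹ * I₁ * J₁⁻¹))))
        (J₂⁻¹ * (I₂ + R.transpose * (a • (J₁⁻¹ * I₁ * J₁⁻¹)) * R) * J₂⁻¹) := by
  rw [triangularInv, Matrix.fromBlocks_transpose, Matrix.fromBlocks_multiply,
    Matrix.fromBlocks_multiply]
  simp only [Matrix.transpose_neg, Matrix.transpose_mul, Matrix.transpose_nonsing_inv,
    transpose_eq_of_posDef h₁, transpose_eq_of_posDef h₂, Matrix.transpose_transpose,
    Matrix.transpose_zero]
  simp [Matrix.mul_assoc, Matrix.mul_add, Matrix.add_mul, add_comm]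

end Sandwich

/-! ### Asymptotic normality of the two-stage estimator -/

theorem mainTheorem5
    {𝒳₁ 𝒳₂ : Type*} [MeasurableSpace 𝒳₁] [MeasurableSpace 𝒳₂] {d₁ d₂ : ℕ}
    (m : CutModel 𝒳₁ 𝒳₂ d₁ d₂)
    {Ω : Type*} [MeasurableSpace Ω] (P : Measure Ω) [IsProbabilityMeasure P]
    (p₁ : 𝒳₁ → ℝ≥0∞) (p₂ : 𝒳₂ → ℝ≥0∞)
    (X₁ : ℕ → Ω → 𝒳₁) (X₂ : ℕ → Ω → 𝒳₂)
    (hdata : m.IndependentData P p₁ p₂ X₁ X₂)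
    (θ₁s : EuclideanSpace ℝ (Fin d₁)) (θ₂s : EuclideanSpace ℝ (Fin d₂))
    (hlog : m.LogLikCondition (m.ν₁.withDensity p₁) (m.ν₂.withDensity p₂))
    (hident : m.IdentifiabilityCondition (m.ν₁.withDensity p₁) (m.ν₂.withDensity p₂)
      P X₁ X₂ θ₁s θ₂s)
    (r₁ r₂ : ℝ) (hr₁ : 0 < r₁) (hr₂ : 0 < r₂)
    (hsmooth : m.SmoothnessCondition (m.ν₁.withDensity p₁) (m.ν₂.withDensity p₂) θ₁s θ₂s r₁ r₂)
    (hpos : m.PosDefCondition (m.ν₁.withDensity p₁) (m.ν₂.withDensity p₂) θ₁s θ₂s r₁ r₂)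
    (n₁ n₂ : ℕ → ℕ) (hn₁ : Tendsto n₁ atTop atTop) (hn₂ : Tendsto n₂ atTop atTop)
    (α : ℝ) (hα : 0 < α)
    (hratio : Tendsto (fun k => (n₁ k : ℝ) / (n₂ k : ℝ)) atTop (𝓝 α))
    (θ₁hat : ℕ → Ω → EuclideanSpace ℝ (Fin d₁)) (θ₂hat : ℕ → Ω → EuclideanSpace ℝ (Fin d₂))
    (hmeas₁ : ∀ k, AEMeasurable (θ₁hat k) P) (hmeas₂ : ∀ k, AEMeasurable (θ₂hat k) P)
    (hmle₁ : Tendsto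
      (fun k => P {ω | ¬ m.IsFirstStageMLE (n₁ k) (fun j => X₁ j ω) (θ₁hat k ω)}) atTop (𝓝 0))
    (hmle₂ : Tendsto
      (fun k => P {ω | ¬ m.IsSecondStageMLE (n₂ k) (fun j => X₂ j ω) (θ₁hat k ω) (θ₂hat k ω)})
      atTop (𝓝 0)) :
    (m.asympCov (m.ν₁.withDensity p₁) (m.ν₂.withDensity p₂) θ₁s θ₂s α).PosSemidef ∧
    TendstoInDistribution
      (fun (k : ℕ) (ω : Ω) =>
        √(n₂ k : ℝ) • joinParam (θ₁hat k ω - θ₁s) (θ₂hat k ω - θ₂s))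
      atTop (id : EuclideanSpace ℝ (Fin d₁ ⊕ Fin d₂) → EuclideanSpace ℝ (Fin d₁ ⊕ Fin d₂))
      (fun _ => P)
      (multivariateGaussian 0
        (m.asympCov (m.ν₁.withDensity p₁) (m.ν₂.withDensity p₂) θ₁s θ₂s α)) := by
  set Q₁ := m.ν₁.withDensity p₁
  set Q₂ := m.ν₂.withDensity p₂
  have hX₁ : IsIIDSample P Q₁ X₁ := ⟨hdata.measurable₁, hdata.law₁, hdata.indep₁⟩
  have hX₂ : IsIIDSample P Q₂ X₂ := ⟨hdata.measurable₂, hdata.law₂, hdata.indep₂⟩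
  have := hX₁.isProbabilityMeasure
  have := hX₂.isProbabilityMeasure
  set θs : EuclideanSpace ℝ (Fin d₁ ⊕ Fin d₂) := joinParam θ₁s θ₂s with hθs
  have hb₁ : θ₁s ∈ Metric.ball θ₁s r₁ := Metric.mem_ball_self hr₁
  have hb₂ : θ₂s ∈ Metric.ball θ₂s r₂ := Metric.mem_ball_self hr₂
  have hI₁ := hpos.posDef_I₁ _ hb₁
  have hJ₁ := hpos.posDef_J₁ _ hb₁
  have hI₂ := hpos.posDef_I₂ _ hb₁ _ hb₂
  have hJ₂ := hpos.posDef_J₂ _ hb₁ _ hb₂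
  set J₁ := m.J₁ Q₁ θ₁s with hJ₁def
  set J₂ := m.J₂ Q₂ θ₁s θ₂s with hJ₂def
  set R := m.RJ Q₂ θ₁s θ₂s with hRdef
  set Kinv := triangularInv J₁ J₂ R with hKinv
  set V := Matrix.fromBlocks (α⁻¹ • m.I₁ Q₁ θ₁s) 0 0 (m.I₂ Q₂ θ₁s θ₂s) with hVdef
  have hV : V.PosSemidef := posSemidef_fromBlocks_diagonal (hI₁.smul (by positivity)) hI₂
  have hcov : m.asympCov Q₁ Q₂ θ₁s θ₂s α = Kinv * V * Kinv.transpose := by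
    rw [hKinv, hVdef, triangularInv_sandwich R _ _ _ hJ₁ hJ₂, CutModel.asympCov, one_div]
    rfl
  rw [hcov]
  refine ⟨by simpa [Matrix.conjTranspose_eq_transpose_of_trivial]
    using hV.mul_mul_conjTranspose_same Kinv, ?_⟩
  -- smoothness, consistency and the estimating equations
  obtain ⟨r, hr, hsub⟩ := exists_ball_subset_nbhd θ₁s θ₂s hr₁ hr₂
  obtain ⟨G₁, G₂, G₃, hS₁⟩ := hsmooth.smoothLogLik₁ hr₁
  obtain ⟨G₄, G₅, G₆, hS₂⟩ := hsmooth.smoothLogLik₂ hr hsub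
  have hc₁ := CutModel.tendsto_firstStage hX₁ hlog hident hn₁ hmle₁
  have hc₂ := CutModel.tendsto_secondStage hX₂ hident hsmooth hsub hS₂ hn₂ hc₁ hmle₂
  have hc : Tendsto (fun p : ℕ × Ω => joinParam (θ₁hat p.1 p.2) (θ₂hat p.1 p.2)) (whp P)
      (𝓝 θs) := (continuous_joinParam.tendsto (θ₁s, θ₂s)).comp (hc₁.prodMk_nhds hc₂)
  -- the scores
  set g₁ : 𝒳₁ → EuclideanSpace ℝ (Fin d₁) := fun x =>
    WithLp.toLp 2 fun i => pderiv i (m.ell₁ x) θ₁s with hg₁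
  set g₂ : 𝒳₂ → EuclideanSpace ℝ (Fin d₂) := fun x =>
    WithLp.toLp 2 fun i => pderiv (Sum.inr i) (m.ell₂ x) θs with hg₂
  have hm₁ : AEMeasurable g₁ Q₁ := (WithLp.measurable_toLp 2 _).comp_aemeasurable
    (aemeasurable_pi_lambda _ fun i => hS₁.aemeasurable_score hS₁.mem_ball i)
  have hm₂ : AEMeasurable g₂ Q₂ := (WithLp.measurable_toLp 2 _).comp_aemeasurable
    (aemeasurable_pi_lambda _ fun i => hS₂.aemeasurable_score hS₂.mem_ball (Sum.inr i))
  have h0₁ : ∀ i, ∫ x, g₁ x i ∂Q₁ = 0 := fun i =>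
    hS₁.integral_score_eq_zero (hlog.integrable₁ _ hident.unique₁.1) i
      (hident.unique₁.isLocalMax_line
        (mem_of_superset (Metric.ball_mem_nhds _ hr₁) hsmooth.ball_subset₁) i)
  have h0₂ : ∀ i, ∫ x, g₂ x i ∂Q₂ = 0 := fun i => by
    refine hS₂.integral_score_eq_zero
      (hlog.integrable₂ _ hident.unique₁.1 _ hident.unique₂.1) (Sum.inr i) ?_
    simpa only [joinParam_add_single_inr] using hident.unique₂.isLocalMax_line
      (mem_of_superset (Metric.ball_mem_nhds _ hr₂) hsmooth.ball_subset₂) i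
  -- The second moment matrices of `g₁` and `g₂` are `I₁` and `I₂` by definition, so `hV` applies as
  -- it stands.
  have hclt := tendstoInDistribution_joinParam_average_of_aemeasurable hX₁ hX₂ hdata.indep₁₂ hm₁ hm₂
    (fun i => hS₁.memLp_score i) (fun i => hS₂.memLp_score (Sum.inr i)) h0₁ h0₂ hn₁ hn₂ hα hratio
    hV
  -- linearization
  set u : ℕ × Ω → EuclideanSpace ℝ (Fin d₁ ⊕ Fin d₂) := fun p =>
    joinParam (θ₁hat p.1 p.2 - θ₁s) (θ₂hat p.1 p.2 - θ₂s) with hu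
  set v : ℕ × Ω → EuclideanSpace ℝ (Fin d₁ ⊕ Fin d₂) := fun p => joinParam
    ((n₁ p.1 : ℝ)⁻¹ • ∑ j ∈ Finset.range (n₁ p.1), g₁ (X₁ j p.2))
    ((n₂ p.1 : ℝ)⁻¹ • ∑ j ∈ Finset.range (n₂ p.1), g₂ (X₂ j p.2)) with hv
  set K := Matrix.fromBlocks J₁ 0 R.transpose J₂ with hK
  -- Turns the first-stage error `o(‖θ₁hat - θ₁s‖)` into `o(‖u‖)`.
  have hfst : (fun p : ℕ × Ω => θ₁hat p.1 p.2 - θ₁s) =O[whp P] u := by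
    refine Asymptotics.IsBigO.of_bound 1 (Eventually.of_forall fun p => ?_)
    rw [one_mul, EuclideanSpace.norm_eq, EuclideanSpace.norm_eq]
    refine Real.sqrt_le_sqrt ?_
    rw [Fintype.sum_sum_type]
    exact le_add_of_nonneg_right (Finset.sum_nonneg fun _ _ => sq_nonneg _)
  have hlin : (fun p => v p - Matrix.toEuclideanCLM (𝕜 := ℝ) K (u p)) =o[whp P] u := by
    refine isLittleO_euclidean fun i => ?_
    rcases i with i | i
    · have h := (hS₁.isLittleO_score hX₁ hn₁ hc₁ i
        (CutModel.eventually_firstStage_score_eq_zero hX₁ hsmooth hS₁ hmle₁ hc₁ i)).trans_isBigO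
          hfst
      refine h.congr_left fun p => ?_
      -- `isLittleO_score` produces column `i` of the Hessian, whereas `K` acts through row `i`; the
      -- symmetry of `J₁` reconciles them. In the second block `J₂` is handled alike, and `R` enters
      -- transposed.
      have hsym : ∀ l, negHessianMatrix Q₁ m.ell₁ θ₁s l i = J₁ i l := fun l =>
        congrFun (congrFun (transpose_eq_of_posDef hJ₁) i) l
      simp [hv, hu, hK, joinParam, Matrix.mulVec, dotProduct, hsym, hg₁, mul_comm]
    · have h := hS₂.isLittleO_score hX₂ hn₂ hc (Sum.inr i)
        (CutModel.eventually_secondStage_score_eq_zero hX₂ hsmooth hsub hS₂ hmle₂ hc i)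
      simp only [joinParam_sub] at h
      refine h.congr_left fun p => ?_
      have hsym : ∀ l, negHessianMatrix Q₂ m.ell₂ θs (Sum.inr l) (Sum.inr i) = J₂ i l := fun l =>
        congrFun (congrFun (transpose_eq_of_posDef hJ₂) i) l
      have hR : ∀ l, negHessianMatrix Q₂ m.ell₂ θs (Sum.inl l) (Sum.inr i) = R l i := fun l => rfl
      simp only [← hθs, Fintype.sum_sum_type, hsym, hR]
      simp [hv, hu, hK, joinParam, Matrix.mulVec, dotProduct, hg₂, mul_comm]
  set L := Matrix.toEuclideanCLM (𝕜 := ℝ) Kinv with hL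
  have hequiv : (fun p => u p - L (v p)) =o[whp P] fun p => L (v p) := by
    -- Apply the bounded map `L = K⁻¹` to the linearization. The error is relative to `u`; symmetry
    -- of asymptotic equivalence makes it relative to `L v`, whose limit law is known.
    have h1 : (fun p => L (v p) - u p) =o[whp P] u := by
      refine (L.isBigO_comp _ _).trans_isLittleO hlin |>.congr_left fun p => ?_
      rw [map_sub, hL, ← mul_apply_eq_comp, ← map_mul, hKinv, hK,
        triangularInv_mul R hJ₁ hJ₂, map_one, one_apply_eq_self]
    exact Asymptotics.IsEquivalent.symm (u := fun p => L (v p)) (v := u) h1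
  have hL_clt := (hclt.continuous_comp L.continuous).of_map_eq (Z' := id)
    (μ'' := multivariateGaussian 0 (Kinv * V * Kinv.transpose)) aemeasurable_id (by
      rw [Measure.map_id, ← map_toEuclideanCLM_multivariateGaussian hV Kinv]; rfl)
  refine tendstoInDistribution_of_isLittleO_whp hL_clt ?_ fun k => ?_
  -- A relative error is unaffected by the common factor `√n₂`.
  · have h := (Asymptotics.isBigO_refl (fun p : ℕ × Ω => √(n₂ p.1 : ℝ)) (whp P)).smul_isLittleO
      hequiv
    refine h.congr (fun p => ?_) fun p => ?_
    · simp [hu, hv, smul_sub]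
    · simp [hv]
  · exact (measurable_joinParam.comp_aemeasurable
      (((hmeas₁ k).sub_const _).prodMk ((hmeas₂ k).sub_const _))).fun_const_smul (M := ℝ) _
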